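/- Let $N\ge 3$ and let $\mathfrak g_N$ be the real Lie algebra with basis $X_1,\dots,X_N$ and non-trivial brackets $[X_N,X_{j+1}]=X_j$ ($1\le j\le N-2$); let $G_N=\exp\mathfrak g_N$, $\mathfrak b=\mathrm{span}\{X_1,\dots,X_{N-1}\}$ and $B=\exp\mathfrak b$. For $\xi\in\mathfrak b^*$ put $t\cdot\xi=\xi\circ\mathrm{Ad}(\exp(-tX_N))$ and $\hat\xi(t)=(t\cdot\xi)(X_{N-1})$, a polynomial in $t$; call $\xi$ a character if $\xi(X_j)=0$ for all $j\le N-2$. Let $S_N^{gen}$ be the set of all $\xi\in\mathfrak b^*$ for which there is $j\le N-2$ with $\xi(X_j)\neq0$, $\xi(X_i)=0$ for $i<j$ and $\xi(X_{j+1})=0$, and let $\pi_\xi=\mathrm{ind}_B^{G_N}\chi_\xi$, where $\chi_\xi(\exp U)=e^{-2\pi i\xi(U)}$ for $U\in\mathfrak b$. Let $(\ell_k)_k$ be a sequence in $S_N^{gen}$ such that $(\pi_{\ell_k})_k$ is properly convergent in $\widehat G_N$ (it converges, and each of its cluster points is a limit). Suppose that it has perfect data, that is: $\hat\ell_k(t)=c_k\prod_{j=1}^d(t-a_j^k)$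 for all $k$, with $d$ independent of $k$, $c_k\ne0$ and $a_j^k\in\mathbb C$; and there are $0<m\le 2d$ and real sequences $(t_i^k)_k$, $1\le i\le m$, such that 1. $t_i^k\cdot\ell_k\to\ell^i$ in $\mathfrak b^*$ as $k\to\infty$, for every $i$; 2. $|t_i^k-t_{i'}^k|\to\infty$ for $i\ne i'$; 3. writing $C=\{i:\ell^i\text{ is a character}\}$, for every $i\in C$: (a) $|t_i^k-a_j^k|\to\infty$ for all $j$; (b) there is an index $j(i)$ with $\rho_i^k:=|t_i^k-a_{j(i)}^k|\le|t_i^k-a_j^k|$ for all $j,k$; (c) there is $L(i)\subset\{1,\dots,d\}$ such that $|t_i^k-a_j^k|/\rho_i^k$ has a finite limit for $j\in L(i)$ and tends to $+\infty$ for $j\notin L(i)$; (d) there is a real polynomial $p^i$ of degree $\#L(i)$ such that for every $s\in\mathbb R$ the functions $x\mapsto\hat\ell_k(x+t_i^k+s\rho_i^k)$ converge, uniformly on compacta, to the constant $p^i(s)$; (e) $L(i)\cap L(i')=\emptyset$ for $i\neq i'$ in $C$; 4. put $D=\{1,\dots,m\}\setminus C$ and $\rho_i^k=1$ for $i\in D$;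 whenever $x_k\cdot\ell_k\to\xi$ for a real sequence $(x_k)_k$, then along some subsequence: if $\xi$ is not a character, $|x_k-t_i^k|$ is bounded for some $i\in D$; if $\xi$ is a character, there are $i\in C$ and $j\in L(i)$ such that $|x_k-a_j^k|/|t_i^k-a_j^k|$ has a finite limit and $\xi(X_{N-1})=p^i(s)$ for some $s\in\mathbb R$; 5. call a real sequence $(s_k)_k$ adapted if $s_k\to+\infty$; $s_k/|t_i^k-a_j^k|\to0$ for all $i\in D$ and all $j$ with $|t_i^k-a_j^k|\to\infty$; and, for all $i\in C$, $s_k/\rho_i^k\to0$ and $s_k\rho_i^k/|t_i^k-a_j^k|\to0$ for all $j\notin L(i)$. Then for every adapted $(s_k)_k$ and all $x_k\notin\bigcup_i[t_i^k-s_k\rho_i^k,\,t_i^k+s_k\rho_i^k]$ we have $x_k\cdot\ell_k\to\infty$. Fix an adapted sequence $(s_k)_k$, a function $\eta\in C_c^\infty(\mathbb R,\mathbb C)$ with $\|\eta\|_{L^2}=1$, and $i\in C$. For $u=(a,b)\in\mathbb R^2$ let $\eta(i,k,u)(x)=\eta\big(s_kp^i(x/\rho_i^k)+s_kb\big)e^{2\pi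 i a x}$ (in the exponent $i$ is the imaginary unit) and let $P_{i,k,u}\xi=\langle\xi,\eta(i,k,u)\rangle\,\eta(i,k,u)$ on $L^2(\mathbb R)$. For a Schwartz function $\varphi$ on $\mathbb R^2$ let $$\nu(\varphi)(i,k)=s_k\int_{\mathbb R^2}\hat\varphi(a,-b)\,P_{i,k,(a,b)}\,da\,db .$$ Let $C^*(\mathbb R^2)$ be the $C^*$-algebra generated by the operators of convolution with functions in $L^1(\mathbb R^2)$, acting on $L^2(\mathbb R^2)$. Then, for all large $k$, $\varphi\mapsto\nu(\varphi)(i,k)$ extends by continuity from the Schwartz functions to $C^*(\mathbb R^2)$, and for all $\varphi,\psi\in C^*(\mathbb R^2)$ $$\lim_{k\to\infty}\big\|\nu(\varphi)(i,k)\circ\nu(\psi)(i,k)-\nu(\varphi\psi)(i,k)\big\|_{op}=0 .$$ -/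

import Mathlib

open MeasureTheory Filter Topology Matrix
open scoped SchwartzMap FourierTransform ContDiff

noncomputable section

/-! ### Operators given by strong integrals -/

section StrongIntegral

variable {X H : Type*} [MeasurableSpace X] [NormedAddCommGroup H] [InnerProductSpace ℂ H]

theorem integrable_smul_isometry {μ : Measure X} {f : X → ℂ} (hf : Integrable f μ)
    {U : X → H → H} (hn : ∀ x ξ, ‖U x ξ‖ = ‖ξ‖)
    (hU : ∀ ξ, AEStronglyMeasurable (fun x => U x ξ) μ) (ξ : H) :
    Integrable (fun x => f x • U x ξ) μ := by
  refine (hf.norm.mul_const ‖ξ‖).mono' (hf.aestronglyMeasurable.smul (hU ξ)) ?_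
  filter_upwards with x
  rw [norm_smul, hn]

/-- The operator `ξ ↦ ∫ f(x) U(x) ξ dμ(x)`, for an integrable `f` and a strongly measurable
family `U` of linear isometries. -/
def strongIntegral (μ : Measure X) (f : X → ℂ) (hf : Integrable f μ)
    (U : X → H ≃ₗᵢ[ℂ] H) (hU : ∀ ξ, AEStronglyMeasurable (fun x => U x ξ) μ) : H →L[ℂ] H :=
  LinearMap.mkContinuous
    { toFun := fun ξ => ∫ x, f x • U x ξ ∂μ
      map_add' := fun ξ ζ => by
        have h := fun ξ => integrable_smul_isometry (U := fun x => U x) hf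
          (fun x ξ => (U x).norm_map ξ) hU ξ
        rw [← integral_add (h ξ) (h ζ)]
        simp only [map_add, smul_add]
      map_smul' := fun c ξ => by
        simp only [map_smul, RingHom.id_apply]
        rw [← integral_smul]
        simp only [smul_comm c] }
    (∫ x, ‖f x‖ ∂μ)
    (fun ξ => by
      refine (norm_integral_le_integral_norm _).trans (le_of_eq ?_)
      simp only [norm_smul, LinearIsometryEquiv.norm_map]
      exact integral_mul_const _ _)

end StrongIntegral

/-! ### The unitary dual of a group and its topology -/

/-- An irreducible unitary representation of `G` (strongly continuous, on a Hilbert space). -/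
structure UnitaryIrrep (G : Type) [Group G] [TopologicalSpace G] where
  H : Type
  [normed : NormedAddCommGroup H]
  [inner : InnerProductSpace ℂ H]
  [complete : CompleteSpace H]
  [nontrivial : Nontrivial H]
  π : G →* (H ≃ₗᵢ[ℂ] H)
  continuous_orbit : ∀ ξ : H, Continuous fun g => π g ξ
  irreducible : ∀ W : Submodule ℂ H, IsClosed (W : Set H) →
    (∀ g, ∀ ξ ∈ W, π g ξ ∈ W) → W = ⊥ ∨ W = ⊤

attribute [instance] UnitaryIrrep.normed UnitaryIrrep.inner UnitaryIrrep.complete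

section Dual

variable (G : Type) [Group G] [TopologicalSpace G]

/-- Unitary equivalence. -/
instance UnitaryIrrep.instSetoid : Setoid (UnitaryIrrep G) where
  r σ τ := ∃ W : σ.H ≃ₗᵢ[ℂ] τ.H, ∀ g ξ, W (σ.π g ξ) = τ.π g (W ξ)
  iseqv :=
    { refl := fun σ => ⟨LinearIsometryEquiv.refl ℂ σ.H, fun _ _ => rfl⟩
      symm := fun {σ τ} h => by
        obtain ⟨W, hW⟩ := h
        refine ⟨W.symm, fun g ξ => W.injective ?_⟩
        rw [hW]
        simp
      trans := fun {σ τ υ} h h' => by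
        obtain ⟨W, hW⟩ := h
        obtain ⟨W', hW'⟩ := h'
        refine ⟨W.trans W', fun g ξ => ?_⟩
        simp [hW, hW'] }

/-- The unitary dual. -/
def UnitaryDual : Type 1 := Quotient (UnitaryIrrep.instSetoid G)

variable {G} [SecondCountableTopology G] [MeasureSpace G] [OpensMeasurableSpace G]

/-- The operator `σ(f) = ∫ f(g) σ(g) dg`, for `f ∈ L¹(G)`. -/
def UnitaryIrrep.ofL1 (σ : UnitaryIrrep G) (f : G → ℂ) (hf : Integrable f) :
    σ.H →L[ℂ] σ.H :=
  strongIntegral volume f hf (fun g => σ.π g)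
    (fun ξ => (σ.continuous_orbit ξ).aestronglyMeasurable)

/-- The Fell (hull-kernel) topology on irreducible representations: it is generated by the sets
`{σ | ‖σ(f)‖ > c}`, where `f ∈ L¹(G)` and `c ∈ ℝ` (the space `L¹(G)` is dense in the
group `C*`-algebra). Here `volume` is meant to be a Haar measure of `G`. -/
instance UnitaryIrrep.instTopologicalSpace : TopologicalSpace (UnitaryIrrep G) :=
  TopologicalSpace.generateFrom
    {S | ∃ (f : G → ℂ) (hf : Integrable f) (c : ℝ), S = {σ | c < ‖σ.ofL1 f hf‖}}

instance UnitaryDual.instTopologicalSpace : TopologicalSpace (UnitaryDual G) :=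
  inferInstanceAs (TopologicalSpace (Quotient (UnitaryIrrep.instSetoid G)))

end Dual

/-- A convergent sequence all of whose cluster points are limits. -/
def ProperlyConvergent {Y : Type*} [TopologicalSpace Y] (x : ℕ → Y) : Prop :=
  (∃ y, Tendsto x atTop (𝓝 y)) ∧ ∀ y, MapClusterPt y atTop x → Tendsto x atTop (𝓝 y)

/-! ### The thread-like groups -/

/-- The matrix of `Ad (exp (t X_N)) = exp (t ad X_N)` on the abelian ideal
`𝔟 = span {X_1, …, X_{N-1}}`, where `[X_N, X_{j+1}] = X_j` and `[X_N, X_1] = 0`.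
The index `j : Fin (N - 1)` stands for the basis vector `X_{j+1}`. -/
def adMat (N : ℕ) (t : ℝ) : Matrix (Fin (N - 1)) (Fin (N - 1)) ℝ :=
  fun j m => if j ≤ m then t ^ (m.val - j.val) / ((m.val - j.val).factorial : ℝ) else 0

theorem adMat_zero (N : ℕ) : adMat N 0 = 1 := by
  ext j m
  unfold adMat
  rw [Matrix.one_apply]
  rcases lt_trichotomy j m with h | h | h
  · have h2 : m.val - j.val ≠ 0 := by have := Fin.lt_def.1 h; omega
    simp [h.le, h.ne, h2]
  · subst h; simp
  · simp [not_le.2 h, h.ne']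

theorem adMat_add (N : ℕ) (s t : ℝ) : adMat N (s + t) = adMat N s * adMat N t := by
  ext j n
  rw [Matrix.mul_apply]
  unfold adMat
  by_cases hjn : j ≤ n
  · rw [if_pos hjn]
    have hle : j.val ≤ n.val := hjn
    let F : ℕ → ℝ := fun m =>
      (if j.val ≤ m then s ^ (m - j.val) / ((m - j.val).factorial : ℝ) else 0) *
      (if m ≤ n.val then t ^ (n.val - m) / ((n.val - m).factorial : ℝ) else 0)
    have h1 : ∑ m : Fin (N - 1),
        (if j ≤ m then s ^ (m.val - j.val) / ((m.val - j.val).factorial : ℝ) else 0) *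
        (if m ≤ n then t ^ (n.val - m.val) / ((n.val - m.val).factorial : ℝ) else 0)
        = ∑ m ∈ Finset.range (N - 1), F m := (Fin.sum_univ_eq_sum_range F (N - 1))
    have h2 : ∑ m ∈ Finset.Ico j.val (n.val + 1), F m = ∑ m ∈ Finset.range (N - 1), F m := by
      refine Finset.sum_subset (fun m hm => ?_) (fun m _ hm => ?_)
      · have := (Finset.mem_Ico.1 hm).2
        have := n.isLt
        exact Finset.mem_range.2 (by omega)
      · have h3 : ¬ (j.val ≤ m ∧ m < n.val + 1) := fun h => hm (Finset.mem_Ico.2 h)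
        by_cases h4 : j.val ≤ m
        · have h5 : ¬ m ≤ n.val := fun h => h3 ⟨h4, Nat.lt_succ_of_le h⟩
          simp [F, h5]
        · simp [F, h4]
    rw [h1, ← h2, Finset.sum_Ico_eq_sum_range, Nat.succ_sub hle, add_pow, Finset.sum_div]
    refine Finset.sum_congr rfl fun k hk => ?_
    have hk' : k ≤ n.val - j.val := Nat.lt_succ_iff.1 (Finset.mem_range.1 hk)
    have e1 : j.val ≤ j.val + k := Nat.le_add_right _ _
    have e2 : j.val + k ≤ n.val := by omega
    have e3 : j.val + k - j.val = k := by omega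
    have e4 : n.val - (j.val + k) = n.val - j.val - k := by omega
    simp only [F, if_pos e1, if_pos e2, e3, e4]
    rw [Nat.cast_choose ℝ hk']
    have a1 : ((n.val - j.val).factorial : ℝ) ≠ 0 := by positivity
    have a2 : (k.factorial : ℝ) ≠ 0 := by positivity
    have a3 : ((n.val - j.val - k).factorial : ℝ) ≠ 0 := by positivity
    field_simp
  · rw [if_neg hjn]
    symm
    refine Finset.sum_eq_zero fun m _ => ?_
    by_cases h1 : j ≤ m
    · have h2 : ¬ m ≤ n := fun h => hjn (h1.trans h)
      simp [h2]
    · simp [h1]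

/-- The connected, simply connected thread-like group `G_N`; the pair `(t, u)` stands for
`exp (t X_N) exp (u_1 X_1 + ⋯ + u_{N-1} X_{N-1})`. -/
def ThreadlikeGroup (N : ℕ) : Type := ℝ × (Fin (N - 1) → ℝ)

namespace ThreadlikeGroup

variable (N : ℕ)

instance : TopologicalSpace (ThreadlikeGroup N) :=
  inferInstanceAs (TopologicalSpace (ℝ × (Fin (N - 1) → ℝ)))

instance : SecondCountableTopology (ThreadlikeGroup N) :=
  inferInstanceAs (SecondCountableTopology (ℝ × (Fin (N - 1) → ℝ)))

/-- Lebesgue measure in the above coordinates, which is a Haar measure. -/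
instance : MeasureSpace (ThreadlikeGroup N) :=
  inferInstanceAs (MeasureSpace (ℝ × (Fin (N - 1) → ℝ)))

instance : BorelSpace (ThreadlikeGroup N) :=
  inferInstanceAs (BorelSpace (ℝ × (Fin (N - 1) → ℝ)))

instance : Group (ThreadlikeGroup N) where
  mul g h := (g.1 + h.1, adMat N (-h.1) *ᵥ g.2 + h.2)
  one := ((0 : ℝ), (0 : Fin (N - 1) → ℝ))
  inv g := (-g.1, -(adMat N g.1 *ᵥ g.2))
  mul_assoc a b c := by
    refine Prod.ext (add_assoc a.1 b.1 c.1) ?_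
    change adMat N (-c.1) *ᵥ (adMat N (-b.1) *ᵥ a.2 + b.2) + c.2
      = adMat N (-(b.1 + c.1)) *ᵥ a.2 + (adMat N (-c.1) *ᵥ b.2 + c.2)
    rw [Matrix.mulVec_add, Matrix.mulVec_mulVec, ← adMat_add, neg_add_rev, add_assoc]
  one_mul a := by
    refine Prod.ext (zero_add a.1) ?_
    change adMat N (-a.1) *ᵥ (0 : Fin (N - 1) → ℝ) + a.2 = a.2
    rw [Matrix.mulVec_zero, zero_add]
  mul_one a := by
    refine Prod.ext (add_zero a.1) ?_
    change adMat N (-0) *ᵥ a.2 + (0 : Fin (N - 1) → ℝ) = a.2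
    rw [neg_zero, adMat_zero, Matrix.one_mulVec, add_zero]
  inv_mul_cancel a := by
    refine Prod.ext (neg_add_cancel a.1) ?_
    change adMat N (-a.1) *ᵥ (-(adMat N a.1 *ᵥ a.2)) + a.2 = 0
    rw [Matrix.mulVec_neg, Matrix.mulVec_mulVec, ← adMat_add, neg_add_cancel, adMat_zero,
      Matrix.one_mulVec, neg_add_cancel]

end ThreadlikeGroup

/-- `V = {ξ ∈ 𝔤_N^* | ξ_N = 0} = 𝔟^*`, in the coordinates `(ξ_1, …, ξ_{N-1})`. -/
abbrev BDual (N : ℕ) : Type := Fin (N - 1) → ℝ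

/-- The action `t · ξ = Ad^*(exp (t X_N)) ξ = ξ ∘ Ad (exp (-t X_N))` of `ℝ` on `𝔟^*`. -/
def coadj {N : ℕ} (t : ℝ) (ξ : BDual N) : BDual N := ξ ᵥ* adMat N (-t)

/-- The polynomial function `ξ̂(t) = (t · ξ)_{N-1} = ∑ (-t)^r / r! ξ_{N-1-r}`. -/
def hat {N : ℕ} (ξ : BDual N) (t : ℝ) : ℝ :=
  ∑ j : Fin (N - 1), (-t) ^ (N - 2 - j.val) / ((N - 2 - j.val).factorial : ℝ) * ξ j

/-- `ξ` is (the restriction to `𝔟` of) a character: it vanishes on `X_1, …, X_{N-2}`. -/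
def IsCharacter {N : ℕ} (ξ : BDual N) : Prop := ∀ j : Fin (N - 1), j.val < N - 2 → ξ j = 0

/-- The set `S_N^gen`: for some `j ≤ N - 2`, the only nonzero coordinates are
the `j`-th (which is nonzero) and some with index at least `j + 2`. -/
def SGen (N : ℕ) : Set (BDual N) :=
  {ξ | ∃ j : Fin (N - 1), j.val < N - 2 ∧ ξ j ≠ 0 ∧
    (∀ i : Fin (N - 1), i < j → ξ i = 0) ∧ ∀ i : Fin (N - 1), i.val = j.val + 1 → ξ i = 0}

/-- `L²(ℝ)`. -/
abbrev L2R : Type := Lp ℂ 2 (volume : Measure ℝ)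

/-- The class `σ` contains the representation `π_ξ = ind_B^G χ_ξ`, which acts on `L²(ℝ)` by
`π_ξ(exp (t X_N) exp u) f(s) = exp (-2πi ⟨ξ, Ad (exp ((t - s) X_N)) u⟩) f(s - t)`. -/
def IsClassOf {N : ℕ} (ξ : BDual N) (σ : UnitaryDual (ThreadlikeGroup N)) : Prop :=
  ∃ τ : UnitaryIrrep (ThreadlikeGroup N), Quotient.mk _ τ = σ ∧
    ∃ W : τ.H ≃ₗᵢ[ℂ] L2R, ∀ (g : ThreadlikeGroup N) (f : τ.H),
      W (τ.π g f) =ᵐ[volume] fun s : ℝ =>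
        Complex.exp (-2 * Real.pi * Complex.I * ((ξ ⬝ᵥ (adMat N (g.1 - s) *ᵥ g.2) : ℝ) : ℂ))
          * (W f : ℝ → ℂ) (s - g.1)

/-! ### Perfect data -/

/-- The data attached to a sequence of polynomials `p_k(t) = c_k ∏_j (t - a_j^k)`. The fields
`L` and `p` matter only at the indices `i` for which the limit `lim i` is a character. -/
structure LimitData (N : ℕ) where
  /-- the degree of all `p_k` -/
  d : ℕ
  /-- the number of limits -/
  m : ℕ
  /-- the leading coefficient `c_k` -/
  c : ℕ → ℝ
  /-- the complex roots `a_j^k` -/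
  a : Fin d → ℕ → ℂ
  /-- the translations `t_i^k` -/
  t : Fin m → ℕ → ℝ
  /-- the limits `ℓ^i` -/
  lim : Fin m → BDual N
  /-- the scales `ρ_i^k` -/
  ρ : Fin m → ℕ → ℝ
  /-- the sets `L(i)` of roots at distance of order `ρ_i^k` of `t_i^k` -/
  L : Fin m → Finset (Fin d)
  /-- the polynomials `p^i` -/
  p : Fin m → Polynomial ℝ

namespace LimitData

variable {N : ℕ} (P : LimitData N)

/-- The index set `C` of the character limits. Its complement is `D`. -/
def C : Set (Fin P.m) := {i | IsCharacter (P.lim i)}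

/-- The distance `|x - a_j^k|`. -/
def rootDist (k : ℕ) (j : Fin P.d) (x : ℝ) : ℝ := ‖(x : ℂ) - P.a j k‖

/-- The sequence `(s_k)` is adapted. -/
structure Adapted (s : ℕ → ℝ) : Prop where
  tendsto_atTop : Tendsto s atTop atTop
  of_notMem : ∀ i ∉ P.C, ∀ j,
    Tendsto (fun k => P.rootDist k j (P.t i k)) atTop atTop →
      Tendsto (fun k => s k / P.rootDist k j (P.t i k)) atTop (𝓝 0)
  of_mem : ∀ i ∈ P.C, ∀ j ∉ P.L i,
    Tendsto (fun k => s k * P.ρ i k / P.rootDist k j (P.t i k)) atTop (𝓝 0)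
  scale : ∀ i ∈ P.C, Tendsto (fun k => s k / P.ρ i k) atTop (𝓝 0)

/-- `P` is a system of perfect data for the sequence `(ℓ_k)`. -/
structure IsPerfectFor (ℓ : ℕ → BDual N) : Prop where
  m_pos : 0 < P.m
  m_le : P.m ≤ 2 * P.d
  c_ne_zero : ∀ k, P.c k ≠ 0
  factor : ∀ k (x : ℝ), ((hat (ℓ k) x : ℝ) : ℂ) = P.c k * ∏ j, ((x : ℂ) - P.a j k)
  tendsto_lim : ∀ i, Tendsto (fun k => coadj (P.t i k) (ℓ k)) atTop (𝓝 (P.lim i))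
  separated : ∀ i i', i ≠ i' → Tendsto (fun k => |P.t i k - P.t i' k|) atTop atTop
  /- the character limits -/
  rootDist_atTop : ∀ i ∈ P.C, ∀ j, Tendsto (fun k => P.rootDist k j (P.t i k)) atTop atTop
  rho_char : ∀ i ∈ P.C, ∃ j₀, ∀ k, P.ρ i k = P.rootDist k j₀ (P.t i k) ∧
    ∀ j, P.rootDist k j₀ (P.t i k) ≤ P.rootDist k j (P.t i k)
  mem_L : ∀ i ∈ P.C, ∀ j ∈ P.L i,
    ∃ r : ℝ, Tendsto (fun k => P.rootDist k j (P.t i k) / P.ρ i k) atTop (𝓝 r)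
  notMem_L : ∀ i ∈ P.C, ∀ j ∉ P.L i,
    Tendsto (fun k => P.rootDist k j (P.t i k) / P.ρ i k) atTop atTop
  tendsto_p : ∀ i ∈ P.C, ∀ s : ℝ, TendstoLocallyUniformly
    (fun k x => hat (ℓ k) (x + (P.t i k + s * P.ρ i k))) (fun _ : ℝ => (P.p i).eval s) atTop
  natDegree_p : ∀ i ∈ P.C, (P.p i).natDegree = (P.L i).card
  disjoint_L : ∀ i ∈ P.C, ∀ i' ∈ P.C, i ≠ i' → Disjoint (P.L i) (P.L i')
  /- the other limits -/
  rho_gen : ∀ i ∉ P.C, ∀ k, P.ρ i k = 1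
  /- Every limit of a sequence `x_k · ℓ_k` comes, after passing to a subsequence, from one of
  the given ones. -/
  exhausts_gen : ∀ (x : ℕ → ℝ) (ξ : BDual N),
    Tendsto (fun k => coadj (x k) (ℓ k)) atTop (𝓝 ξ) → ¬ IsCharacter ξ →
      ∃ φ : ℕ → ℕ, StrictMono φ ∧ ∃ i ∉ P.C, ∃ R : ℝ, ∀ k, |x (φ k) - P.t i (φ k)| ≤ R
  exhausts_char : ∀ (x : ℕ → ℝ) (ξ : BDual N),
    Tendsto (fun k => coadj (x k) (ℓ k)) atTop (𝓝 ξ) → IsCharacter ξ →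
      ∃ φ : ℕ → ℕ, StrictMono φ ∧ ∃ i ∈ P.C,
        (∃ j ∈ P.L i, ∃ r : ℝ, Tendsto (fun k => P.rootDist (φ k) j (x (φ k)) /
          P.rootDist (φ k) j (P.t i (φ k))) atTop (𝓝 r)) ∧
        ∃ s : ℝ, ∀ j : Fin (N - 1), j.val = N - 2 → ξ j = (P.p i).eval s
  /- away from the intervals of radius `s_k ρ_i^k` around the `t_i^k`, the orbits go to infinity -/
  escapes : ∀ s : ℕ → ℝ, P.Adapted s → ∀ x : ℕ → ℝ,
    (∀ k i, x k ∉ Set.Icc (P.t i k - s k * P.ρ i k) (P.t i k + s k * P.ρ i k)) →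
      Tendsto (fun k => coadj (x k) (ℓ k)) atTop (cocompact (BDual N))

end LimitData

/-! ### The `C*`-algebra of `ℝ²` -/

/-- The plane. -/
abbrev Plane : Type := EuclideanSpace ℝ (Fin 2)

/-- `L²(ℝ²)`. -/
abbrev L2Plane : Type := Lp ℂ 2 (volume : Measure Plane)

/-- The translation operator `(τ_y f)(x) = f(-y + x)` on `L²(ℝ²)`. -/
def planeTranslation (y : Plane) : L2Plane ≃ₗᵢ[ℂ] L2Plane where
  toFun f := DomAddAct.mk (-y) +ᵥ f
  invFun f := DomAddAct.mk y +ᵥ f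
  left_inv f := by
    change DomAddAct.mk y +ᵥ (DomAddAct.mk (-y) +ᵥ f) = f
    rw [vadd_vadd, ← DomAddAct.mk_add, neg_add_cancel, DomAddAct.mk_zero, zero_vadd]
  right_inv f := by
    change DomAddAct.mk (-y) +ᵥ (DomAddAct.mk y +ᵥ f) = f
    rw [vadd_vadd, ← DomAddAct.mk_add, add_neg_cancel, DomAddAct.mk_zero, zero_vadd]
  map_add' f g := DomAddAct.vadd_Lp_add _ f g
  map_smul' c f := by
    rcases f with ⟨⟨_⟩, _⟩
    rfl
  norm_map' f := DomAddAct.norm_vadd_Lp _ f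

theorem continuous_planeTranslation (f : L2Plane) :
    Continuous fun y => planeTranslation y f := by
  have : Fact ((2 : ENNReal) ≠ ⊤) := ⟨ENNReal.ofNat_ne_top⟩
  have h : Continuous fun y : Plane => DomAddAct.mk (-y) +ᵥ f :=
    (DomAddAct.continuous_mk.comp continuous_neg).vadd continuous_const
  exact h

/-- The convolution operator `ξ ↦ f ∗ ξ = ∫ f(y) τ_y ξ dy` on `L²(ℝ²)`, for `f ∈ L¹(ℝ²)`. -/
def convOp (f : Plane → ℂ) (hf : Integrable f) : L2Plane →L[ℂ] L2Plane :=
  strongIntegral volume f hf planeTranslation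
    (fun ξ => (continuous_planeTranslation ξ).aestronglyMeasurable)

/-- `C*(ℝ²)`, the `C*`-algebra generated by the convolution operators on `L²(ℝ²)`. -/
abbrev CStarPlane : NonUnitalStarSubalgebra ℂ (L2Plane →L[ℂ] L2Plane) :=
  (NonUnitalStarAlgebra.adjoin ℂ
    {T | ∃ (f : Plane → ℂ) (hf : Integrable f), T = convOp f hf}).topologicalClosure

/-- The inclusion of the Schwartz space in `C*(ℝ²)`. -/
def schwartzToCStar (φ : 𝓢(Plane, ℂ)) : CStarPlane :=
  ⟨convOp φ φ.integrable, NonUnitalStarSubalgebra.le_topologicalClosure _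
    (NonUnitalStarAlgebra.subset_adjoin ℂ _ ⟨φ, φ.integrable, rfl⟩)⟩

/-! ### The maps `ν` -/

section Nu

variable (η : ℝ → ℂ) (p : Polynomial ℝ) (r s : ℝ)

/-- The function `η(s p(x / r) + s b) exp (2πi a x)` of `x`, where `u = (a, b)`. -/
def waveFun (u : Plane) (x : ℝ) : ℂ :=
  η (s * p.eval (x / r) + s * u 1) * Complex.exp (2 * Real.pi * Complex.I * u 0 * x)

open Classical in
/-- The previous function, as an element of `L²(ℝ)`. (It is square integrable, even a test
function, if `η` is a test function, `p` is not constant and `s, r ≠ 0`.) -/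
def waveVec (u : Plane) : L2R :=
  if h : MemLp (waveFun η p r s u) 2 volume then h.toLp _ else 0

/-- The operator of rank one `ξ ↦ ⟨ξ, η_u⟩ η_u`. -/
def waveProj (u : Plane) : L2R →L[ℂ] L2R :=
  InnerProductSpace.rankOne ℂ (waveVec η p r s u) (waveVec η p r s u)

/-- `ν(φ) = s ∫ φ̂(a, -b) P_{(a, b)} da db`, for a Schwartz function `φ`. -/
def nuSchwartz (φ : 𝓢(Plane, ℂ)) : L2R →L[ℂ] L2R :=
  (s : ℂ) • ∫ u : Plane, 𝓕 (φ : Plane → ℂ) (!₂[u 0, -u 1]) • waveProj η p r s u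

/-- The extension of `ν` to `C*(ℝ²)` by continuity. -/
def nu (φ : CStarPlane) : L2R →L[ℂ] L2R :=
  limUnder (comap schwartzToCStar (𝓝 φ)) (nuSchwartz η p r s)

end Nu

namespace LimitData

/-- The operator `ν(φ)(i, k)`. -/
def nu {N : ℕ} (P : LimitData N) (s : ℕ → ℝ) (η : ℝ → ℂ) (i : Fin P.m) (k : ℕ)
    (φ : CStarPlane) : L2R →L[ℂ] L2R :=
  _root_.nu η (P.p i) (P.ρ i k) (s k) φ

end LimitData

end

/-!
# Asymptotic multiplicativity of the maps `ν`

Write `q(x) = p(x / r)`, and let `g` be the Fourier transform of `b ↦ √s conj (η (s b))`, so that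
`‖g‖ = 1`. The map `(Vξ)(x, w) = ξ(x) exp (2πi q(x) w) g(w)` is an isometry of `L²(ℝ)` into
`L²(ℝ²)` (`packetTransform`). The Fourier transform of `Vξ` at `(a, b)` is
`√s ⟨ξ, η_{(a, -b)}⟩`, and the Fourier transform turns the convolution by `φ` into the
multiplication by `φ̂`. Comparing matrix coefficients one finds `ν(φ) = V* (φ ∗ ·) V` for every
Schwartz function `φ` (`nuSchwartz_eq`). The right-hand side makes sense for every operator
`T ∈ C*(ℝ²)`, with norm at most `‖T‖`, and the Schwartz functions are dense in `C*(ℝ²)`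
(`denseRange_schwartzToCStar`); hence the extension of `ν` by continuity is the compression
`ν(T) = V* T V`.

For compressions, `ν(S) ν(T) - ν(S T) = -V* S (1 - V V*) T V`, so it is enough that the range of `V`
is almost invariant under `T`, and by density one may assume that `T` is the convolution by a
Schwartz function `ψ`, that is, a superposition of translations. Two facts are used.

* A translation by `w` in the second variable maps `Vξ` to `V(exp (-2πi q w) ξ)`, up to an error
  caused by the translation of the envelope `g`, which is `O(|w| / s)` because `g` is spread out
  over a scale `s`.
* After integration over `w`, the function `exp (-2πi q w) ξ` becomes `G(t, q) ξ`, where `G` is the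
  partial Fourier transform of `ψ` and decays in both variables. A translation by `t` in the first
  variable then commutes with `V` up to an error of size `s |q(x + t) - q(x)| |G(t, q(x))|`. As `q`
  is a polynomial in `x / r`, its variation is at most `(1 + |q(x)|) / r` times a constant and a
  power of `1 + |t|`, and the decay of `G` makes the error `O(s / r)`, uniformly in `x`.

Thus the defect is `O(1 / s + s / r)` (`exists_norm_convOp_waveIsometry_sub_le`), which tends to `0`
for an adapted sequence. At a character the scale `r = ρ_i^k` tends to infinity, and the
polynomial `p^i` is not constant because the nearest root belongs to `L(i)`; the latter ensures
that the functions `η_u` are square integrable.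
-/

noncomputable section

/-! ### Square integrable functions on the line and on the plane -/

theorem eLpNorm_two_sq {α : Type*} [MeasurableSpace α] {μ : Measure α} (f : α → ℂ) :
    eLpNorm f 2 μ ^ 2 = ∫⁻ x, ‖f x‖ₑ ^ 2 ∂μ := by
  rw [eLpNorm_eq_lintegral_rpow_enorm_toReal two_ne_zero ENNReal.ofNat_ne_top]
  simp only [ENNReal.toReal_ofNat, ENNReal.rpow_ofNat, one_div]
  rw [← ENNReal.rpow_natCast, ← ENNReal.rpow_mul]
  norm_num

theorem enorm_sq_eq_lintegral {α : Type*} [MeasurableSpace α] {μ : Measure α} (f : Lp ℂ 2 μ) :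
    ‖f‖ₑ ^ 2 = ∫⁻ x, ‖f x‖ₑ ^ 2 ∂μ := by
  rw [Lp.enorm_def, eLpNorm_two_sq]

theorem norm_le_of_lintegral_le {α β : Type*} [MeasurableSpace α] [MeasurableSpace β]
    {μ : Measure α} {ν : Measure β} (f : Lp ℂ 2 μ) (g : Lp ℂ 2 ν) {κ : ℝ} (hκ : 0 ≤ κ)
    (h : ∫⁻ x, ‖f x‖ₑ ^ 2 ∂μ ≤ ENNReal.ofReal (κ ^ 2) * ∫⁻ x, ‖g x‖ₑ ^ 2 ∂ν) :
    ‖f‖ ≤ κ * ‖g‖ := by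
  rw [← enorm_sq_eq_lintegral, ← enorm_sq_eq_lintegral, ← ofReal_norm, ← ofReal_norm,
    ← ENNReal.ofReal_pow (norm_nonneg _), ← ENNReal.ofReal_pow (norm_nonneg _),
    ← ENNReal.ofReal_mul (by positivity), ENNReal.ofReal_le_ofReal_iff (by positivity),
    ← mul_pow] at h
  exact (sq_le_sq₀ (by positivity) (by positivity)).1 h

/-- A dominated convergence theorem in `L²`: a family of functions which depends continuously on
a parameter and is locally dominated is a continuous curve in `L²`. -/
theorem continuous_toLp_of_dominated {Y α : Type*} [TopologicalSpace Y] [FirstCountableTopology Y]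
    [MeasurableSpace α] {μ : Measure α} {F : Y → α → ℂ} (hF : ∀ y, MemLp (F y) 2 μ)
    (hcont : ∀ᵐ x ∂μ, Continuous fun y => F y x)
    (hdom : ∀ y₀, ∃ g : α → ℝ, MemLp g 2 μ ∧ ∀ᶠ y in 𝓝 y₀, ∀ᵐ x ∂μ, ‖F y x‖ ≤ g x) :
    Continuous fun y => (hF y).toLp (F y) := by
  refine continuous_iff_continuousAt.2 fun y₀ => ?_
  obtain ⟨g, hg, hFg⟩ := hdom y₀
  have key : Tendsto (fun y => ∫⁻ x, ‖F y x - F y₀ x‖ₑ ^ 2 ∂μ) (𝓝 y₀) (𝓝 (∫⁻ _, 0 ∂μ)) := by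
    have hfin : ∫⁻ x, ENNReal.ofReal ((2 * g x) ^ 2) ∂μ ≠ ⊤ := by
      have := (hg.const_mul 2).integrable_sq
      rw [← ofReal_integral_eq_lintegral_ofReal this (ae_of_all _ fun x => sq_nonneg _)]
      exact ENNReal.ofReal_ne_top
    refine tendsto_lintegral_filter_of_dominated_convergence'
      (fun x => ENNReal.ofReal ((2 * g x) ^ 2)) (Eventually.of_forall fun y => ?_) ?_ hfin ?_
    · exact ((hF y).sub (hF y₀)).aestronglyMeasurable.enorm.pow_const 2
    · filter_upwards [hFg] with y hy
      filter_upwards [hy, hFg.self_of_nhds] with x h1 h2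
      rw [← ofReal_norm, ← ENNReal.ofReal_pow (norm_nonneg _)]
      gcongr
      calc ‖F y x - F y₀ x‖ ≤ ‖F y x‖ + ‖F y₀ x‖ := norm_sub_le _ _
        _ ≤ 2 * g x := by linarith
    · filter_upwards [hcont] with x hx
      have h1 : Tendsto (fun y => ‖F y x - F y₀ x‖ₑ ^ 2) (𝓝 y₀) (𝓝 (‖F y₀ x - F y₀ x‖ₑ ^ 2)) :=
        ((ENNReal.continuous_pow 2).comp (hx.sub continuous_const).enorm).tendsto _
      simpa using h1
  rw [ContinuousAt, tendsto_iff_norm_sub_tendsto_zero]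
  have h2 : ∀ y, ‖(hF y).toLp (F y) - (hF y₀).toLp (F y₀)‖
      = ((∫⁻ x, ‖F y x - F y₀ x‖ₑ ^ 2 ∂μ) ^ (1 / 2 : ℝ)).toReal := by
    intro y
    rw [← MemLp.toLp_sub, Lp.norm_toLp,
      eLpNorm_eq_lintegral_rpow_enorm_toReal two_ne_zero ENNReal.ofNat_ne_top]
    simp
  simp only [h2]
  have h3 := (ENNReal.tendsto_toReal (a := 0) (by simp)).comp
    ((ENNReal.continuous_rpow_const (y := (1 / 2 : ℝ))).tendsto' 0 0 (by simp))
  rw [lintegral_zero] at key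
  exact h3.comp key

/-! ### Coordinates on the plane -/

/-- The plane as a product of two lines. -/
def planeProd : Plane ≃ᵐ ℝ × ℝ :=
  (MeasurableEquiv.toLp 2 (Fin 2 → ℝ)).symm.trans MeasurableEquiv.finTwoArrow

theorem planeProd_apply (z : Plane) : planeProd z = (z 0, z 1) := rfl

theorem measurePreserving_planeProd : MeasurePreserving planeProd volume volume :=
  (volume_preserving_finTwoArrow ℝ).comp
    (EuclideanSpace.volume_preserving_symm_measurableEquiv_toLp (Fin 2))

theorem lintegral_plane {f : ℝ × ℝ → ENNReal} (hf : AEMeasurable f) :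
    ∫⁻ z : Plane, f (z 0, z 1) = ∫⁻ x, ∫⁻ w, f (x, w) := by
  rw [← lintegral_prod _ hf, ← Measure.volume_eq_prod,
    ← measurePreserving_planeProd.lintegral_comp_emb planeProd.measurableEmbedding]
  rfl

theorem integrable_plane_iff {E : Type*} [NormedAddCommGroup E] {f : ℝ × ℝ → E} :
    Integrable (fun z : Plane => f (z 0, z 1)) ↔ Integrable f :=
  measurePreserving_planeProd.integrable_comp_emb planeProd.measurableEmbedding

theorem integral_plane {E : Type*} [NormedAddCommGroup E] [NormedSpace ℝ E] {f : ℝ × ℝ → E}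
    (hf : Integrable f) : ∫ z : Plane, f (z 0, z 1) = ∫ x, ∫ w, f (x, w) := by
  rw [← integral_prod _ hf, ← Measure.volume_eq_prod,
    ← measurePreserving_planeProd.integral_comp planeProd.measurableEmbedding]
  rfl

theorem quasiMeasurePreserving_coord_zero :
    Measure.QuasiMeasurePreserving (fun z : Plane => z 0) volume volume :=
  Measure.quasiMeasurePreserving_fst.comp measurePreserving_planeProd.quasiMeasurePreserving

theorem planeTranslation_ae (y : Plane) (f : L2Plane) :
    planeTranslation y f =ᵐ[volume] fun z => f (z - y) := by
  have h : planeTranslation y f = DomAddAct.mk (-y) +ᵥ f := rfl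
  rw [h]
  refine (DomAddAct.vadd_Lp_ae_eq (DomAddAct.mk (-y)) f).trans (ae_of_all _ fun z => ?_)
  simp [sub_eq_neg_add]

theorem planeTranslation_add (y z : Plane) (f : L2Plane) :
    planeTranslation (y + z) f = planeTranslation y (planeTranslation z f) := by
  change DomAddAct.mk (-(y + z)) +ᵥ f = DomAddAct.mk (-y) +ᵥ (DomAddAct.mk (-z) +ᵥ f)
  rw [vadd_vadd, ← DomAddAct.mk_add, neg_add_rev]

/-- If `F(x, w) = ξ(x - t) B(x, w)` and the `L²`-norms of the functions `B(x, ·)` are at most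
`κ`, then `‖F‖ ≤ κ ‖ξ‖`. -/
theorem norm_le_of_fiber {F : L2Plane} {ξ : L2R} {B : ℝ × ℝ → ℂ} (hB : Measurable B) {κ t : ℝ}
    (hκ : 0 ≤ κ) (hF : F =ᵐ[volume] fun z : Plane => (ξ : ℝ → ℂ) (z 0 - t) * B (z 0, z 1))
    (h : ∀ x, ∫⁻ w, ‖B (x, w)‖ₑ ^ 2 ≤ ENNReal.ofReal (κ ^ 2)) : ‖F‖ ≤ κ * ‖ξ‖ := by
  refine norm_le_of_lintegral_le F ξ hκ ?_
  have hξ : Measurable (ξ : ℝ → ℂ) := (Lp.stronglyMeasurable ξ).measurable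
  calc ∫⁻ z, ‖F z‖ₑ ^ 2 = ∫⁻ z : Plane, ‖(ξ : ℝ → ℂ) (z 0 - t) * B (z 0, z 1)‖ₑ ^ 2 := by
        refine lintegral_congr_ae ?_
        filter_upwards [hF] with z hz
        rw [hz]
    _ = ∫⁻ x, ∫⁻ w, ‖(ξ : ℝ → ℂ) (x - t) * B (x, w)‖ₑ ^ 2 :=
        lintegral_plane (f := fun x : ℝ × ℝ => ‖(ξ : ℝ → ℂ) (x.1 - t) * B x‖ₑ ^ 2)
          (by fun_prop)
    _ ≤ ∫⁻ x, ENNReal.ofReal (κ ^ 2) * ‖(ξ : ℝ → ℂ) (x - t)‖ₑ ^ 2 := by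
        refine lintegral_mono fun x => ?_
        simp only [enorm_mul, mul_pow]
        rw [lintegral_const_mul _ (by fun_prop), mul_comm]
        gcongr
        exact h x
    _ = ENNReal.ofReal (κ ^ 2) * ∫⁻ x, ‖(ξ : ℝ → ℂ) x‖ₑ ^ 2 := by
        rw [lintegral_const_mul _ (by fun_prop)]
        congr 1
        exact lintegral_sub_right_eq_self (fun x => ‖(ξ : ℝ → ℂ) x‖ₑ ^ 2) t

/-! ### Translations and multiplications on the line -/

/-- The translation operator `(τ_t f)(x) = f(x - t)` on `L²(ℝ)`. -/
def lineTranslation (t : ℝ) : L2R →L[ℂ] L2R :=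
  (Lp.compMeasurePreservingₗᵢ ℂ (fun x : ℝ => x - t)
    (measurePreserving_sub_right volume t)).toContinuousLinearMap

theorem lineTranslation_ae (t : ℝ) (f : L2R) :
    lineTranslation t f =ᵐ[volume] fun x => f (x - t) :=
  Lp.coeFn_compMeasurePreserving f (measurePreserving_sub_right volume t)

theorem norm_lineTranslation (t : ℝ) (f : L2R) : ‖lineTranslation t f‖ = ‖f‖ :=
  (Lp.compMeasurePreservingₗᵢ ℂ (fun x : ℝ => x - t)
    (measurePreserving_sub_right volume t)).norm_map f

theorem continuous_lineTranslation (f : L2R) : Continuous fun t => lineTranslation t f := by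
  have : Fact ((2 : ENNReal) ≠ ⊤) := ⟨ENNReal.ofNat_ne_top⟩
  have h : Continuous fun y : ℝ => DomAddAct.mk (-y) +ᵥ f :=
    (DomAddAct.continuous_mk.comp continuous_neg).vadd continuous_const
  refine h.congr fun t => ?_
  refine Lp.ext ?_
  filter_upwards [DomAddAct.vadd_Lp_ae_eq (DomAddAct.mk (-t)) f, lineTranslation_ae t f]
    with x h1 h2
  rw [h1, h2]
  simp [sub_eq_neg_add]

theorem memLp_unitary_mul {u : ℝ → ℂ} (hu : Measurable u) (hu1 : ∀ x, ‖u x‖ = 1) (f : L2R) :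
    MemLp (fun x => u x * (f : ℝ → ℂ) x) 2 :=
  (Lp.memLp f).congr_norm (hu.aestronglyMeasurable.mul (Lp.aestronglyMeasurable f))
    (ae_of_all _ fun x => by rw [norm_mul, hu1, one_mul])

/-! ### Wave packet transforms -/

theorem norm_fourierChar_sub_le (a b : ℝ) :
    ‖(𝐞 a : ℂ) - 𝐞 b‖ ≤ 2 * Real.pi * |a - b| := by
  have h : (𝐞 a : ℂ) - 𝐞 b
      = 𝐞 b * (Complex.exp (Complex.I * (2 * Real.pi * (a - b) : ℝ)) - 1) := by
    rw [Real.fourierChar_apply, Real.fourierChar_apply, mul_sub, ← Complex.exp_add, mul_one]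
    congr 2
    push_cast
    ring
  rw [h, norm_mul, Circle.norm_coe, one_mul]
  refine (Real.norm_exp_I_mul_ofReal_sub_one_le).trans (le_of_eq ?_)
  rw [Real.norm_eq_abs, abs_mul, abs_of_pos (by positivity)]

/-- A strongly continuous family of isometries is jointly continuous. -/
theorem continuous_isometry_apply {Y E F : Type*} [TopologicalSpace Y] [PseudoMetricSpace E]
    [PseudoMetricSpace F] {U : Y → E → F} (hU : ∀ y, Isometry (U y))
    (hU' : ∀ ξ, Continuous fun y => U y ξ) {c : Y → E} (hc : Continuous c) :
    Continuous fun y => U y (c y) := by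
  refine continuous_iff_continuousAt.2 fun y₀ => ?_
  rw [ContinuousAt, tendsto_iff_dist_tendsto_zero]
  have h1 := tendsto_iff_dist_tendsto_zero.1 (hc.tendsto y₀)
  have h2 := tendsto_iff_dist_tendsto_zero.1 ((hU' (c y₀)).tendsto y₀)
  refine squeeze_zero (fun _ => dist_nonneg) (fun y => ?_) (by simpa using h1.add h2)
  refine (dist_triangle _ (U y (c y₀)) _).trans (le_of_eq ?_)
  rw [(hU y).dist_eq]

section Packet

variable {q : ℝ → ℝ}

/-- The wave packet with frequency `q(x)` and envelope `g`, as a function of `(x, w)`. -/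
def packetKernel (q : ℝ → ℝ) (g : 𝓢(ℝ, ℂ)) (x : ℝ × ℝ) : ℂ := 𝐞 (q x.1 * x.2) * g x.2

theorem norm_packetKernel (g : 𝓢(ℝ, ℂ)) (x : ℝ × ℝ) : ‖packetKernel q g x‖ = ‖g x.2‖ := by
  rw [packetKernel, norm_mul, Circle.norm_coe, one_mul]

theorem continuous_packetKernel (hq : Continuous q) (g : 𝓢(ℝ, ℂ)) :
    Continuous (packetKernel q g) := by
  have := g.continuous
  unfold packetKernel
  fun_prop

theorem aestronglyMeasurable_comp_coord_zero {f : ℝ → ℂ} (hf : AEStronglyMeasurable f) :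
    AEStronglyMeasurable (fun z : Plane => f (z 0)) :=
  hf.comp_quasiMeasurePreserving quasiMeasurePreserving_coord_zero

theorem aestronglyMeasurable_packet (hq : Continuous q) (g : 𝓢(ℝ, ℂ)) {f : ℝ → ℂ}
    (hf : AEStronglyMeasurable f) :
    AEStronglyMeasurable fun z : Plane => f (z 0) * packetKernel q g (z 0, z 1) := by
  refine (aestronglyMeasurable_comp_coord_zero hf).mul ?_
  exact ((continuous_packetKernel hq g).comp (by fun_prop)).aestronglyMeasurable

theorem lintegral_packet (g : 𝓢(ℝ, ℂ)) (ξ : L2R) :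
    ∫⁻ z : Plane, ‖(ξ : ℝ → ℂ) (z 0) * packetKernel q g (z 0, z 1)‖ₑ ^ 2
      = ‖ξ‖ₑ ^ 2 * ∫⁻ w, ‖g w‖ₑ ^ 2 := by
  have hξ : Measurable (ξ : ℝ → ℂ) := (Lp.stronglyMeasurable ξ).measurable
  have hg : Measurable g := g.continuous.measurable
  have h : ∀ x : ℝ × ℝ, ‖(ξ : ℝ → ℂ) x.1 * packetKernel q g x‖ₑ ^ 2
      = ‖(ξ : ℝ → ℂ) x.1‖ₑ ^ 2 * ‖g x.2‖ₑ ^ 2 := fun x => by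
    rw [enorm_mul, mul_pow, ← ofReal_norm (packetKernel q g x), norm_packetKernel, ofReal_norm]
  refine (lintegral_congr fun z : Plane => h (z 0, z 1)).trans ?_
  rw [lintegral_plane (f := fun x : ℝ × ℝ => ‖(ξ : ℝ → ℂ) x.1‖ₑ ^ 2 * ‖g x.2‖ₑ ^ 2)
    (by fun_prop), enorm_sq_eq_lintegral]
  simp only
  rw [← lintegral_mul_const _ (by fun_prop)]
  congr 1 with x
  rw [lintegral_const_mul _ (by fun_prop)]

theorem memLp_packet (hq : Continuous q) (g : 𝓢(ℝ, ℂ)) (hg : ∫⁻ w, ‖g w‖ₑ ^ 2 = 1) (ξ : L2R) :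
    MemLp (fun z : Plane => (ξ : ℝ → ℂ) (z 0) * packetKernel q g (z 0, z 1)) 2 := by
  refine ⟨aestronglyMeasurable_packet hq g (Lp.aestronglyMeasurable ξ), ?_⟩
  rw [← ENNReal.pow_lt_top_iff.trans (or_iff_left two_ne_zero), eLpNorm_two_sq,
    lintegral_packet, hg, mul_one]
  exact ENNReal.pow_lt_top enorm_lt_top

theorem memLp_phaseMul (hq : Continuous q) (w : ℝ) (ξ : L2R) :
    MemLp (fun x => (𝐞 (-(q x * w)) : ℂ) * (ξ : ℝ → ℂ) x) 2 :=
  memLp_unitary_mul (u := fun x => (𝐞 (-(q x * w)) : ℂ))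
    (by fun_prop) (fun _ => Circle.norm_coe _) ξ

variable (hq : Continuous q) (g : 𝓢(ℝ, ℂ))

/-- The isometry `(Vξ)(x, w) = ξ(x) exp (2πi q(x) w) g(w)` of `L²(ℝ)` into `L²(ℝ²)`,
where `‖g‖ = 1`. -/
def packetTransform (hg : ∫⁻ w, ‖g w‖ₑ ^ 2 = 1) : L2R →ₗᵢ[ℂ] L2Plane where
  toFun ξ := (memLp_packet hq g hg ξ).toLp _
  map_add' ξ ζ := by
    rw [← MemLp.toLp_add]
    refine MemLp.toLp_congr _ _ ?_
    filter_upwards [quasiMeasurePreserving_coord_zero.ae (Lp.coeFn_add ξ ζ)] with z hz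
    simp only [Pi.add_apply] at hz ⊢
    rw [hz, add_mul]
  map_smul' c ξ := by
    rw [RingHom.id_apply, ← MemLp.toLp_const_smul]
    refine MemLp.toLp_congr _ _ ?_
    filter_upwards [quasiMeasurePreserving_coord_zero.ae (Lp.coeFn_smul c ξ)] with z hz
    simp only [Pi.smul_apply] at hz ⊢
    rw [hz, smul_mul_assoc]
  norm_map' ξ := by
    have h : ‖(memLp_packet hq g hg ξ).toLp _‖ₑ ^ 2 = ‖ξ‖ₑ ^ 2 := by
      rw [Lp.enorm_toLp, eLpNorm_two_sq, lintegral_packet, hg, mul_one]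
    have h' := (ENNReal.pow_right_strictMono two_ne_zero).injective h
    exact (toReal_enorm _).symm.trans ((congrArg _ h').trans (toReal_enorm _))

variable (hg : ∫⁻ w, ‖g w‖ₑ ^ 2 = 1)

theorem packetTransform_ae (ξ : L2R) : packetTransform hq g hg ξ =ᵐ[volume]
    fun z : Plane => (ξ : ℝ → ℂ) (z 0) * packetKernel q g (z 0, z 1) :=
  (memLp_packet hq g hg ξ).coeFn_toLp

/-- The multiplication by the function `exp (-2πi q(x) w)` of `x`. -/
def phaseMul (w : ℝ) (ξ : L2R) : L2R := (memLp_phaseMul hq w ξ).toLp _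

theorem phaseMul_ae (w : ℝ) (ξ : L2R) :
    phaseMul hq w ξ =ᵐ[volume] fun x => (𝐞 (-(q x * w)) : ℂ) * (ξ : ℝ → ℂ) x :=
  (memLp_phaseMul hq w ξ).coeFn_toLp

theorem norm_phaseMul (w : ℝ) (ξ : L2R) : ‖phaseMul hq w ξ‖ = ‖ξ‖ := by
  rw [phaseMul, Lp.norm_toLp, Lp.norm_def]
  congr 1
  refine eLpNorm_congr_norm_ae (ae_of_all _ fun x => ?_)
  rw [norm_mul, Circle.norm_coe, one_mul]

theorem continuous_phaseMul (ξ : L2R) : Continuous fun w => phaseMul hq w ξ := by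
  refine continuous_toLp_of_dominated (fun w => memLp_phaseMul hq w ξ)
    (ae_of_all _ fun x => by fun_prop) fun w₀ => ⟨fun x => ‖(ξ : ℝ → ℂ) x‖, (Lp.memLp ξ).norm, ?_⟩
  refine Eventually.of_forall fun w => ae_of_all _ fun x => ?_
  rw [norm_mul, Circle.norm_coe, one_mul]

/-- The wave packet transform turns a translation in the second variable into the multiplication
by a phase, up to the effect of the translation on the envelope. -/
theorem norm_planeTranslation_packetTransform_sub {κ : ℝ} (hκ : 0 ≤ κ) (w : ℝ)
    (h : ∫⁻ v, ‖g (v - w) - g v‖ₑ ^ 2 ≤ ENNReal.ofReal (κ ^ 2)) (ξ : L2R) :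
    ‖planeTranslation !₂[0, w] (packetTransform hq g hg ξ)
      - packetTransform hq g hg (phaseMul hq w ξ)‖ ≤ κ * ‖ξ‖ := by
  have hgm := g.continuous
  refine norm_le_of_fiber (t := 0)
    (B := fun x => 𝐞 (q x.1 * (x.2 - w)) * (g (x.2 - w) - g x.2)) (by fun_prop) hκ ?_ fun x => ?_
  · filter_upwards [Lp.coeFn_sub (planeTranslation !₂[0, w] (packetTransform hq g hg ξ))
      (packetTransform hq g hg (phaseMul hq w ξ)),
      planeTranslation_ae !₂[0, w] (packetTransform hq g hg ξ),
      (measurePreserving_sub_right volume !₂[0, w]).quasiMeasurePreserving.ae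
        (packetTransform_ae hq g hg ξ),
      packetTransform_ae hq g hg (phaseMul hq w ξ),
      quasiMeasurePreserving_coord_zero.ae (phaseMul_ae hq w ξ)] with z h1 h2 h3 h4 h5
    rw [h1, Pi.sub_apply, h2, h3, h4, h5]
    have e : q (z 0) * (z 1 - w) = q (z 0) * z 1 + -(q (z 0) * w) := by ring
    simp only [packetKernel, PiLp.sub_apply, Matrix.cons_val_zero, Matrix.cons_val_one, sub_zero,
      Matrix.cons_val_fin_one]
    rw [e, AddChar.map_add_eq_mul, Circle.coe_mul]
    ring
  · refine (lintegral_congr fun v => ?_).trans_le h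
    rw [← ofReal_norm, norm_mul, Circle.norm_coe, one_mul, ofReal_norm]

/-- The wave packet transform almost intertwines the translations in the first variable with those
on the line, where the frequency `q` varies slowly. -/
theorem norm_planeTranslation_packetTransform_sub' {κ K : ℝ} (hκ : 0 ≤ κ) (t : ℝ)
    (hK : ∫⁻ w : ℝ, ‖(w : ℂ) * g w‖ₑ ^ 2 ≤ ENNReal.ofReal (K ^ 2)) (hK0 : 0 ≤ K)
    {ξ ζ : L2R} {m : ℝ → ℂ} (hm : Measurable m)
    (hζ : ζ =ᵐ[volume] fun x => m x * (ξ : ℝ → ℂ) x)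
    (h : ∀ x, ‖m x‖ * (2 * Real.pi * |q (x + t) - q x|) * K ≤ κ) :
    ‖planeTranslation !₂[t, 0] (packetTransform hq g hg ζ)
      - packetTransform hq g hg (lineTranslation t ζ)‖ ≤ κ * ‖ξ‖ := by
  have hgm := g.continuous
  refine norm_le_of_fiber (t := t)
    (B := fun x => m (x.1 - t) * (𝐞 (q (x.1 - t) * x.2) - 𝐞 (q x.1 * x.2)) * g x.2)
    (by fun_prop) hκ ?_ fun x => ?_
  · have hζ' := (measurePreserving_sub_right (volume : Measure ℝ) t).quasiMeasurePreserving.ae hζ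
    filter_upwards [Lp.coeFn_sub (planeTranslation !₂[t, 0] (packetTransform hq g hg ζ))
      (packetTransform hq g hg (lineTranslation t ζ)),
      planeTranslation_ae !₂[t, 0] (packetTransform hq g hg ζ),
      (measurePreserving_sub_right volume !₂[t, 0]).quasiMeasurePreserving.ae
        (packetTransform_ae hq g hg ζ),
      packetTransform_ae hq g hg (lineTranslation t ζ),
      quasiMeasurePreserving_coord_zero.ae (lineTranslation_ae t ζ),
      quasiMeasurePreserving_coord_zero.ae hζ'] with z h1 h2 h3 h4 h5 h6
    rw [h1, Pi.sub_apply, h2, h3, h4, h5]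
    simp only [packetKernel, PiLp.sub_apply, Matrix.cons_val_zero, Matrix.cons_val_one, sub_zero,
      Matrix.cons_val_fin_one]
    rw [h6]
    ring
  · calc ∫⁻ w, ‖m (x - t) * ((𝐞 (q (x - t) * w) : ℂ) - 𝐞 (q x * w)) * g w‖ₑ ^ 2
        ≤ ∫⁻ w : ℝ, ENNReal.ofReal ((‖m (x - t)‖ * (2 * Real.pi * |q x - q (x - t)|)) ^ 2)
            * ‖(w : ℂ) * g w‖ₑ ^ 2 := by
          refine lintegral_mono fun w => ?_
          simp only [← ofReal_norm]
          rw [← ENNReal.ofReal_pow (norm_nonneg _), ← ENNReal.ofReal_pow (norm_nonneg _),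
            ← ENNReal.ofReal_mul (by positivity), ← mul_pow, norm_mul, norm_mul, norm_mul]
          gcongr ENNReal.ofReal (?_ ^ 2)
          have h1 := norm_fourierChar_sub_le (q (x - t) * w) (q x * w)
          rw [← sub_mul, abs_mul, abs_sub_comm] at h1
          calc ‖m (x - t)‖ * ‖(𝐞 (q (x - t) * w) : ℂ) - 𝐞 (q x * w)‖ * ‖g w‖
              ≤ ‖m (x - t)‖ * (2 * Real.pi * (|q x - q (x - t)| * |w|)) * ‖g w‖ := by gcongr
            _ = _ := by rw [Complex.norm_real, Real.norm_eq_abs]; ring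
      _ = ENNReal.ofReal ((‖m (x - t)‖ * (2 * Real.pi * |q x - q (x - t)|)) ^ 2)
            * ∫⁻ w : ℝ, ‖(w : ℂ) * g w‖ₑ ^ 2 := by
          rw [lintegral_const_mul _ (by fun_prop)]
      _ ≤ ENNReal.ofReal ((‖m (x - t)‖ * (2 * Real.pi * |q x - q (x - t)|)) ^ 2)
            * ENNReal.ofReal (K ^ 2) := by gcongr
      _ ≤ ENNReal.ofReal (κ ^ 2) := by
          rw [← ENNReal.ofReal_mul (by positivity), ← mul_pow]
          gcongr
          simpa using h (x - t)

theorem continuous_fourier_of_integrable {f : ℝ → ℂ} (hf : Integrable f) : Continuous (𝓕 f) :=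
  VectorFourier.fourierIntegral_continuous Real.continuous_fourierChar
    (L := innerₗ ℝ) continuous_inner hf

theorem integrable_smul_phaseMul {f : ℝ → ℂ} (hf : Integrable f) (ξ : L2R) :
    Integrable fun w => f w • phaseMul hq w ξ :=
  integrable_smul_isometry (U := phaseMul hq) hf (norm_phaseMul hq)
    (fun ξ => (continuous_phaseMul hq ξ).aestronglyMeasurable) ξ

/-- A superposition of multiplications by phases is the multiplication by a Fourier transform. -/
theorem integral_phaseMul_ae {f : ℝ → ℂ} (hf : Integrable f) (ξ : L2R) :
    (∫ w, f w • phaseMul hq w ξ : L2R) =ᵐ[volume] fun x => 𝓕 f (q x) * (ξ : ℝ → ℂ) x := by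
  have hFc := continuous_fourier_of_integrable hf
  have hmem : MemLp (fun x => 𝓕 f (q x) * (ξ : ℝ → ℂ) x) 2 := by
    refine (Lp.memLp ξ).of_le_mul (c := ∫ w, ‖f w‖)
      (((hFc.comp hq).aestronglyMeasurable).mul (Lp.aestronglyMeasurable ξ))
      (ae_of_all _ fun x => ?_)
    rw [norm_mul]
    gcongr
    exact VectorFourier.norm_fourierIntegral_le_integral_norm _ _ _ _ _
  have key : (∫ w, f w • phaseMul hq w ξ : L2R) = hmem.toLp _ := by
    refine ext_inner_left ℂ fun ζ => ?_
    rw [← integral_inner (integrable_smul_phaseMul hq hf ξ), L2.inner_def]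
    have h1 : ∀ w, inner ℂ ζ (f w • phaseMul hq w ξ)
        = ∫ x, f w * (inner ℂ ((ζ : ℝ → ℂ) x) ((ξ : ℝ → ℂ) x) * 𝐞 (-(w * q x))) := by
      intro w
      rw [inner_smul_right, L2.inner_def, ← integral_const_mul]
      refine integral_congr_ae ?_
      filter_upwards [phaseMul_ae hq w ξ] with x hx
      rw [hx, RCLike.inner_apply, RCLike.inner_apply, mul_comm w]
      ring
    simp only [h1]
    rw [integral_integral_swap]
    · refine integral_congr_ae ?_
      filter_upwards [hmem.coeFn_toLp] with x hx
      rw [hx, RCLike.inner_apply, RCLike.inner_apply, Real.fourier_real_eq, ← integral_mul_const,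
        ← integral_mul_const]
      refine integral_congr_ae (ae_of_all _ fun w => ?_)
      simp only [Circle.smul_def, smul_eq_mul]
      ring
    · have h2 := hf.mul_prod (L2.integrable_inner (𝕜 := ℂ) ζ ξ)
      refine h2.congr' ?_ (ae_of_all _ fun y => ?_)
      · have h3 : Continuous fun y : ℝ × ℝ => (𝐞 (-(y.1 * q y.2)) : ℂ) := by fun_prop
        refine (h2.aestronglyMeasurable.mul h3.aestronglyMeasurable).congr
          (ae_of_all _ fun y => ?_)
        simp only [Pi.mul_apply, Function.uncurry]
        ring
      · simp only [Function.uncurry, norm_mul, Circle.norm_coe, mul_one]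
  rw [key]
  exact hmem.coeFn_toLp

/-- The convolution operators almost preserve the range of a wave packet transform. Here `K₁`
controls the translates of the envelope `g`, while `κ` controls the variation of the
frequency `q`, weighted by the decay of the partial Fourier transform of `ψ`. -/
theorem exists_norm_convOp_packetTransform_sub_le (ψ : 𝓢(Plane, ℂ)) {K₁ K₂ : ℝ} {κ : ℝ → ℝ}
    (hK₁ : 0 ≤ K₁) (hK₂ : 0 ≤ K₂)
    (hg₁ : ∀ w, ∫⁻ v, ‖g (v - w) - g v‖ₑ ^ 2 ≤ ENNReal.ofReal ((K₁ * |w|) ^ 2))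
    (hg₂ : ∫⁻ w : ℝ, ‖(w : ℂ) * g w‖ₑ ^ 2 ≤ ENNReal.ofReal (K₂ ^ 2))
    (hκ : Integrable κ) (hκ0 : ∀ t, 0 ≤ κ t)
    (hψ : ∀ t, Integrable fun w => ψ !₂[t, w])
    (h : ∀ t x, ‖𝓕 (fun w => ψ !₂[t, w]) (q x)‖ * (2 * Real.pi * |q (x + t) - q x|) * K₂ ≤ κ t)
    (ξ : L2R) :
    ∃ χ : L2R, ‖convOp ψ ψ.integrable (packetTransform hq g hg ξ) - packetTransform hq g hg χ‖
      ≤ (K₁ * (∫ y : Plane, ‖y‖ * ‖ψ y‖) + ∫ t, κ t) * ‖ξ‖ := by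
  set V := packetTransform hq g hg with hV
  have hV' : ∀ ζ, ‖V ζ‖ = ‖ζ‖ := V.norm_map
  have hc0 : Continuous fun y : Plane => lineTranslation (y 0) (phaseMul hq (y 1) ξ) :=
    continuous_isometry_apply (U := fun y : Plane => lineTranslation (y 0))
      (fun y => AddMonoidHomClass.isometry_of_norm _ (norm_lineTranslation _))
      (fun ξ => (continuous_lineTranslation ξ).comp (by fun_prop))
      ((continuous_phaseMul hq ξ).comp (by fun_prop))
  have hc1 : Continuous fun y : Plane => planeTranslation !₂[y 0, 0] (V (phaseMul hq (y 1) ξ)) :=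
    continuous_isometry_apply (U := fun y : Plane => planeTranslation !₂[y 0, 0])
      (fun y => (planeTranslation _).isometry)
      (fun ξ => (continuous_planeTranslation ξ).comp (by fun_prop))
      (V.continuous.comp ((continuous_phaseMul hq ξ).comp (by fun_prop)))
  have hint : ∀ (c : Plane → L2Plane), Continuous c → (∀ y, ‖c y‖ = ‖ξ‖) →
      Integrable fun y => ψ y • c y := fun c hc hcn => by
    refine (ψ.integrable.norm.mul_const ‖ξ‖).mono'
      (ψ.continuous.aestronglyMeasurable.smul hc.aestronglyMeasurable) (ae_of_all _ fun y => ?_)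
    rw [norm_smul, hcn]
  have i0 := hint _ (continuous_planeTranslation (V ξ))
    (fun y => ((planeTranslation y).norm_map _).trans (hV' ξ))
  have i1 := hint _ hc1 (fun y => ((planeTranslation _).norm_map _).trans
    ((hV' _).trans (norm_phaseMul hq _ _)))
  have i2 : Integrable fun y : Plane =>
      ψ y • V (lineTranslation (y 0) (phaseMul hq (y 1) ξ)) :=
    hint _ (V.continuous.comp hc0) (fun y => (hV' _).trans
    ((norm_lineTranslation _ _).trans (norm_phaseMul hq _ _)))
  have i3 : Integrable fun y : Plane =>
      ψ y • lineTranslation (y 0) (phaseMul hq (y 1) ξ) := by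
    refine (ψ.integrable.norm.mul_const ‖ξ‖).mono'
      (ψ.continuous.aestronglyMeasurable.smul hc0.aestronglyMeasurable) (ae_of_all _ fun y => ?_)
    rw [norm_smul, norm_lineTranslation, norm_phaseMul]
  refine ⟨∫ y : Plane, ψ y • lineTranslation (y 0) (phaseMul hq (y 1) ξ), ?_⟩
  have e1 : convOp ψ ψ.integrable (V ξ) = ∫ y, ψ y • planeTranslation y (V ξ) := rfl
  have e2 : V (∫ y : Plane, ψ y • lineTranslation (y 0) (phaseMul hq (y 1) ξ))
      = ∫ y : Plane, ψ y • V (lineTranslation (y 0) (phaseMul hq (y 1) ξ)) := by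
    rw [← LinearIsometry.coe_toContinuousLinearMap, ← ContinuousLinearMap.integral_comp_comm _ i3]
    simp
  -- the two sources of error: the envelope and the frequency
  have e3 : convOp ψ ψ.integrable (V ξ)
        - V (∫ y : Plane, ψ y • lineTranslation (y 0) (phaseMul hq (y 1) ξ))
      = (∫ y : Plane, (ψ y • planeTranslation y (V ξ)
          - ψ y • planeTranslation !₂[y 0, 0] (V (phaseMul hq (y 1) ξ))))
        + ∫ y : Plane, (ψ y • planeTranslation !₂[y 0, 0] (V (phaseMul hq (y 1) ξ))
          - ψ y • V (lineTranslation (y 0) (phaseMul hq (y 1) ξ))) := by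
    rw [e1, e2, integral_sub i0 i1, integral_sub i1 i2]
    abel
  rw [e3, add_mul]
  refine (norm_add_le _ _).trans (add_le_add ?_ ?_)
  · have hm : Integrable fun y : Plane => K₁ * (‖y‖ * ‖ψ y‖) * ‖ξ‖ := by
      have := ψ.integrable_pow_mul volume 1
      simp only [pow_one] at this
      exact (this.const_mul K₁).mul_const _
    refine (norm_integral_le_of_norm_le hm (ae_of_all _ fun y => ?_)).trans (le_of_eq ?_)
    · have hy : y = !₂[y 0, 0] + !₂[0, y 1] := by
        ext i
        fin_cases i <;> simp
      have e4 : planeTranslation y (V ξ)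
          = planeTranslation !₂[y 0, 0] (planeTranslation !₂[0, y 1] (V ξ)) := by
        rw [← planeTranslation_add, ← hy]
      have h1 := norm_planeTranslation_packetTransform_sub hq g hg (by positivity) (y 1)
        (hg₁ (y 1)) ξ
      rw [← smul_sub, norm_smul, e4, ← map_sub, LinearIsometryEquiv.norm_map]
      have h2 : |y 1| ≤ ‖y‖ := PiLp.norm_apply_le y 1
      calc ‖ψ y‖ * _ ≤ ‖ψ y‖ * (K₁ * ‖y‖ * ‖ξ‖) := by
            refine mul_le_mul_of_nonneg_left (h1.trans ?_) (norm_nonneg _)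
            gcongr
        _ = _ := by ring
    · rw [integral_mul_const, integral_const_mul]
  · let f : ℝ × ℝ → L2Plane := fun x =>
      ψ !₂[x.1, x.2] • planeTranslation !₂[x.1, 0] (V (phaseMul hq x.2 ξ))
          - ψ !₂[x.1, x.2] • V (lineTranslation x.1 (phaseMul hq x.2 ξ))
    have hf : ∀ y : Plane, f (y 0, y 1) =
        ψ y • planeTranslation !₂[y 0, 0] (V (phaseMul hq (y 1) ξ))
          - ψ y • V (lineTranslation (y 0) (phaseMul hq (y 1) ξ)) := fun y => by
      have hy : !₂[y 0, y 1] = y := by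
        ext i
        fin_cases i <;> simp
      simp only [f, hy]
    have hfi : Integrable f := by
      refine integrable_plane_iff.1 ?_
      simp only [hf]
      exact i1.sub i2
    simp only [← hf]
    rw [integral_plane hfi, ← integral_mul_const]
    refine norm_integral_le_of_norm_le (hκ.mul_const _) (ae_of_all _ fun t => ?_)
    let ζ : L2R := ∫ w, ψ !₂[t, w] • phaseMul hq w ξ
    have i4 := integrable_smul_phaseMul hq (hψ t) ξ
    let D : L2R →L[ℂ] L2Plane :=
      (planeTranslation !₂[t, 0]).toContinuousLinearEquiv.toContinuousLinearMap ∘L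
        V.toContinuousLinearMap - V.toContinuousLinearMap ∘L lineTranslation t
    have hD : ∀ ζ, D ζ = planeTranslation !₂[t, 0] (V ζ) - V (lineTranslation t ζ) :=
      fun ζ => rfl
    have e5 : ∫ w, f (t, w) = D ζ := by
      rw [← ContinuousLinearMap.integral_comp_comm _ i4]
      refine integral_congr_ae (ae_of_all _ fun w => ?_)
      simp only [f, map_smul, hD]
    rw [e5, hD]
    exact norm_planeTranslation_packetTransform_sub' hq g hg (hκ0 t) t hg₂ hK₂
      ((continuous_fourier_of_integrable (hψ t)).comp hq).measurable
      (integral_phaseMul_ae hq (hψ t) ξ) (h t)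

end Packet

/-! ### Convolution operators -/

theorem convOp_apply (f : Plane → ℂ) (hf : Integrable f) (ξ : L2Plane) :
    convOp f hf ξ = ∫ y, f y • planeTranslation y ξ := rfl

theorem integrable_smul_planeTranslation {f : Plane → ℂ} (hf : Integrable f) (ξ : L2Plane) :
    Integrable fun y => f y • planeTranslation y ξ :=
  integrable_smul_isometry (U := fun y => planeTranslation y) hf
    (fun y ξ => (planeTranslation y).norm_map ξ)
    (fun ξ => (continuous_planeTranslation ξ).aestronglyMeasurable) ξ

theorem norm_convOp_le (f : Plane → ℂ) (hf : Integrable f) : ‖convOp f hf‖ ≤ ∫ y, ‖f y‖ :=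
  ContinuousLinearMap.opNorm_le_bound _ (integral_nonneg fun _ => norm_nonneg _) fun ξ => by
    rw [convOp_apply, ← integral_mul_const]
    refine norm_integral_le_of_norm_le (hf.norm.mul_const _) (ae_of_all _ fun y => ?_)
    rw [norm_smul, LinearIsometryEquiv.norm_map]

theorem convOp_add {f g : Plane → ℂ} (hf : Integrable f) (hg : Integrable g) :
    convOp f hf + convOp g hg = convOp (f + g) (hf.add hg) := by
  ext1 ξ
  rw [_root_.add_apply, convOp_apply, convOp_apply, convOp_apply,
    ← integral_add (integrable_smul_planeTranslation hf ξ) (integrable_smul_planeTranslation hg ξ)]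
  simp only [Pi.add_apply, add_smul]

theorem convOp_smul {f : Plane → ℂ} (hf : Integrable f) (c : ℂ) :
    c • convOp f hf = convOp (c • f) (hf.smul c) := by
  ext1 ξ
  rw [_root_.smul_apply, convOp_apply, convOp_apply, ← integral_smul]
  simp only [Pi.smul_apply, smul_assoc]

theorem convOp_sub {f g : Plane → ℂ} (hf : Integrable f) (hg : Integrable g) :
    convOp f hf - convOp g hg = convOp (f - g) (hf.sub hg) := by
  ext1 ξ
  rw [_root_.sub_apply, convOp_apply, convOp_apply, convOp_apply,
    ← integral_sub (integrable_smul_planeTranslation hf ξ) (integrable_smul_planeTranslation hg ξ)]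
  simp only [Pi.sub_apply, sub_smul]

theorem convOp_zero : convOp 0 (integrable_zero _ _ _) = 0 := by
  ext1 ξ
  rw [convOp_apply]
  simp

theorem exists_convOp_mul {f g : Plane → ℂ} (hf : Integrable f) (hg : Integrable g) :
    ∃ (h : Plane → ℂ) (hh : Integrable h), convOp f hf * convOp g hg = convOp h hh := by
  have hi := hf.convolution_integrand (ContinuousLinearMap.mul ℂ ℂ) hg
  refine ⟨_, hf.integrable_convolution (ContinuousLinearMap.mul ℂ ℂ) hg, ?_⟩
  ext1 ξ
  have hi' : Integrable (fun p : Plane × Plane =>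
      (f p.2 * g (p.1 - p.2)) • planeTranslation p.1 ξ) (volume.prod volume) := by
    refine (hi.norm.mul_const ‖ξ‖).mono' (hi.aestronglyMeasurable.smul
      ((continuous_planeTranslation ξ).comp continuous_fst).aestronglyMeasurable)
      (ae_of_all _ fun p => ?_)
    rw [norm_smul, LinearIsometryEquiv.norm_map]
    rfl
  calc (convOp f hf * convOp g hg) ξ = ∫ y, f y • planeTranslation y (∫ z, g z •
        planeTranslation z ξ) := rfl
    _ = ∫ y, ∫ z, (f y * g (z - y)) • planeTranslation z ξ := by
        congr 1 with y : 1
        have h1 : planeTranslation y (∫ z, g z • planeTranslation z ξ)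
            = ∫ z, g z • planeTranslation (y + z) ξ := by
          have h2 := ContinuousLinearMap.integral_comp_comm
            (planeTranslation y).toContinuousLinearEquiv.toContinuousLinearMap
            (integrable_smul_planeTranslation hg ξ)
          refine h2.symm.trans ?_
          congr 1 with z : 1
          rw [planeTranslation_add]
          exact (planeTranslation y).map_smul _ _
        rw [h1, ← integral_smul,
          ← integral_sub_right_eq_self (fun z => f y • g z • planeTranslation (y + z) ξ) y]
        simp only [add_sub_cancel, smul_smul]
    _ = ∫ z, ∫ y, (f y * g (z - y)) • planeTranslation z ξ := integral_integral_swap hi'.swap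
    _ = _ := by
        rw [convOp_apply]
        congr 1 with z : 1
        rw [integral_smul_const]
        rfl

theorem exists_star_convOp {f : Plane → ℂ} (hf : Integrable f) :
    ∃ (h : Plane → ℂ) (hh : Integrable h), star (convOp f hf) = convOp h hh := by
  have hh : Integrable fun y => star (f (-y)) :=
    (Complex.conjCLE : ℂ →L[ℝ] ℂ).integrable_comp hf.comp_neg
  refine ⟨_, hh, ?_⟩
  rw [ContinuousLinearMap.star_eq_adjoint]
  symm
  rw [ContinuousLinearMap.eq_adjoint_iff]
  intro ξ ζ
  rw [convOp_apply, convOp_apply, ← integral_inner (integrable_smul_planeTranslation hf ζ),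
    ← inner_conj_symm, ← integral_inner (integrable_smul_planeTranslation hh ξ), ← integral_conj,
    ← integral_neg_eq_self]
  congr 1 with y : 1
  have h1 := (planeTranslation y).inner_map_map (planeTranslation (-y) ξ) ζ
  rw [← planeTranslation_add, add_neg_cancel] at h1
  have h2 : planeTranslation 0 ξ = ξ := by
    change DomAddAct.mk (-(0 : Plane)) +ᵥ ξ = ξ
    rw [neg_zero, DomAddAct.mk_zero, zero_vadd]
  rw [h2] at h1
  rw [inner_smul_right, inner_smul_right, map_mul, inner_conj_symm, h1]
  simp

/-- The convolution operators by integrable functions form a `*`-algebra. -/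
def convAlgebra : NonUnitalStarSubalgebra ℂ (L2Plane →L[ℂ] L2Plane) where
  carrier := {T | ∃ (f : Plane → ℂ) (hf : Integrable f), T = convOp f hf}
  add_mem' := by
    rintro _ _ ⟨f, hf, rfl⟩ ⟨g, hg, rfl⟩
    exact ⟨_, _, convOp_add hf hg⟩
  zero_mem' := ⟨0, integrable_zero _ _ _, convOp_zero.symm⟩
  mul_mem' := by
    rintro _ _ ⟨f, hf, rfl⟩ ⟨g, hg, rfl⟩
    exact exists_convOp_mul hf hg
  smul_mem' := by
    rintro c _ ⟨f, hf, rfl⟩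
    exact ⟨_, _, convOp_smul hf c⟩
  star_mem' := by
    rintro _ ⟨f, hf, rfl⟩
    exact exists_star_convOp hf

theorem exists_schwartz_integral_norm_sub_lt {f : Plane → ℂ} (hf : Integrable f) {ε : ℝ}
    (hε : 0 < ε) : ∃ φ : 𝓢(Plane, ℂ), ∫ y, ‖f y - φ y‖ < ε := by
  obtain ⟨φ, hφ⟩ := (SchwartzMap.denseRange_toLpCLM (E := Plane) (F := ℂ)
    (μ := volume) ENNReal.one_ne_top).exists_dist_lt (hf.toL1 f) hε
  refine ⟨φ, lt_of_eq_of_lt ?_ hφ⟩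
  rw [dist_eq_norm, L1.norm_eq_integral_norm]
  refine integral_congr_ae ?_
  filter_upwards [Lp.coeFn_sub (hf.toL1 f) (SchwartzMap.toLpCLM ℝ ℂ 1 volume φ),
    hf.coeFn_toL1, φ.coeFn_toLp 1 volume] with y h1 h2 h3
  rw [h1, Pi.sub_apply, h2, SchwartzMap.toLpCLM_apply, h3]

/-- The convolution operators by integrable functions already form a `*`-algebra, so the Schwartz
functions are dense in `C*(ℝ²)` because they are dense in `L¹(ℝ²)`. -/
theorem denseRange_schwartzToCStar : DenseRange schwartzToCStar := by
  intro T
  rw [closure_subtype]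
  have h1 : (T : L2Plane →L[ℂ] L2Plane) ∈ closure (convAlgebra : Set (L2Plane →L[ℂ] L2Plane)) :=
    closure_mono (NonUnitalStarAlgebra.adjoin_le fun _ h => h) T.2
  refine closure_minimal ?_ isClosed_closure h1
  rintro _ ⟨f, hf, rfl⟩
  refine Metric.mem_closure_iff.2 fun ε hε => ?_
  obtain ⟨φ, hφ⟩ := exists_schwartz_integral_norm_sub_lt hf hε
  refine ⟨convOp φ φ.integrable, ⟨_, ⟨φ, rfl⟩, rfl⟩, ?_⟩
  rw [dist_eq_norm, convOp_sub]
  exact (norm_convOp_le _ _).trans_lt hφ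

instance neBot_comap_schwartzToCStar (T : CStarPlane) : (comap schwartzToCStar (𝓝 T)).NeBot :=
  comap_neBot_iff_frequently.2 (mem_closure_iff_frequently.1 (denseRange_schwartzToCStar T))

/-! ### The Fourier transform of matrix coefficients -/

theorem fourier_star (f : Plane → ℂ) (u : Plane) :
    𝓕 (fun z => star (f z)) u = star (𝓕 f (-u)) := by
  rw [Real.fourier_eq, Real.fourier_eq]
  refine Eq.trans ?_ integral_conj
  congr 1 with z : 1
  rw [Circle.smul_def, Circle.smul_def, smul_eq_mul, smul_eq_mul, map_mul, inner_neg_right, neg_neg,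
    ← Circle.coe_inv_eq_conj, ← AddChar.map_neg_eq_inv]
  rfl

theorem fourier_comp_neg_apply (f : Plane → ℂ) (u : Plane) :
    𝓕 (fun z => f (-z)) u = 𝓕 f (-u) := by
  rw [Real.fourier_eq, Real.fourier_eq, ← integral_neg_eq_self]
  simp only [neg_neg, inner_neg_left, inner_neg_right]

/-- The Fourier transform diagonalizes the convolution operators. -/
theorem inner_convOp (φ : 𝓢(Plane, ℂ)) (f h : L2Plane) (hf : Integrable (f : Plane → ℂ))
    (hh : Integrable (h : Plane → ℂ)) :
    inner ℂ f (convOp φ φ.integrable h)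
      = ∫ u, 𝓕 (φ : Plane → ℂ) u * (star (𝓕 (f : Plane → ℂ) u) * 𝓕 (h : Plane → ℂ) u) := by
  let F : Plane → ℂ := fun z => star (f z)
  let H : Plane → ℂ := fun z => h (-z)
  have hF : Integrable F := (Complex.conjCLE : ℂ →L[ℝ] ℂ).integrable_comp hf
  have hH : Integrable H := hh.comp_neg
  let c : Plane → ℂ := convolution F H (ContinuousLinearMap.mul ℂ ℂ) volume
  have hc : Integrable c := hF.integrable_convolution (ContinuousLinearMap.mul ℂ ℂ) hH
  have h1 : ∀ y, inner ℂ f (planeTranslation y h) = c y := by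
    intro y
    rw [L2.inner_def]
    refine integral_congr_ae ?_
    filter_upwards [planeTranslation_ae y h] with z hz
    rw [hz, RCLike.inner_apply, mul_comm]
    simp [F, H]
  have h2 : inner ℂ f (convOp φ φ.integrable h) = ∫ y, φ y • c y := by
    rw [convOp_apply, ← integral_inner (integrable_smul_planeTranslation φ.integrable h)]
    simp only [inner_smul_right, h1, smul_eq_mul]
  have h3 : ∀ u, 𝓕 c u = star (𝓕 (f : Plane → ℂ) (-u)) * 𝓕 (h : Plane → ℂ) (-u) := by
    intro u
    rw [Real.fourier_mul_convolution_eq hF hH, fourier_star, fourier_comp_neg_apply]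
  -- `φ` is the Fourier transform of its inverse Fourier transform, which is moved to `c`
  have h4 : ∫ y, φ y • c y = ∫ u, (𝓕⁻ φ : 𝓢(Plane, ℂ)) u • 𝓕 c u := by
    have h5 := VectorFourier.integral_fourierIntegral_smul_eq_flip (L := innerₗ Plane)
      (μ := volume) (ν := volume) Real.continuous_fourierChar continuous_inner
      (𝓕⁻ φ : 𝓢(Plane, ℂ)).integrable hc
    rw [flip_innerₗ] at h5
    refine Eq.trans ?_ h5
    have h6 : ∀ y, φ y = 𝓕 (⇑(𝓕⁻ φ : 𝓢(Plane, ℂ))) y := fun y => by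
      rw [← SchwartzMap.fourier_coe, FourierTransform.fourier_fourierInv_eq]
    simp only [h6]
    rfl
  rw [h2, h4, ← integral_neg_eq_self]
  congr 1 with u : 1
  rw [h3, neg_neg, smul_eq_mul, SchwartzMap.fourierInv_coe, Real.fourierInv_eq_fourier_neg, neg_neg]

/-- The reflection `(a, b) ↦ (a, -b)` of the plane. -/
def planeFlip : Plane ≃ₗᵢ[ℝ] Plane where
  toFun u := !₂[u 0, -u 1]
  invFun u := !₂[u 0, -u 1]
  map_add' u v := by
    ext i
    fin_cases i <;> simp [add_comm]
  map_smul' c u := by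
    ext i
    fin_cases i <;> simp
  left_inv u := by
    ext i
    fin_cases i <;> simp
  right_inv u := by
    ext i
    fin_cases i <;> simp
  norm_map' u := by
    simp [EuclideanSpace.norm_eq, Fin.sum_univ_two]

theorem planeFlip_apply (u : Plane) : planeFlip u = !₂[u 0, -u 1] := rfl

theorem planeFlip_planeFlip (u : Plane) : planeFlip (planeFlip u) = u :=
  planeFlip.left_inv u

/-! ### Polynomials and wave functions -/

/-- A polynomial is dominated by every polynomial of at least the same degree. This controls the
derivatives of `p` by `p` itself, and the variable by `p` if `p` is not constant. -/
theorem exists_abs_eval_le {f p : Polynomial ℝ} (h : f.degree ≤ p.degree) :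
    ∃ C, 0 ≤ C ∧ ∀ y, |f.eval y| ≤ C * (1 + |p.eval y|) := by
  obtain ⟨C, hC, hfp⟩ := (Polynomial.isBigO_cobounded_of_degree_le h).exists_nonneg
  obtain ⟨R, hR⟩ := (Metric.hasBasis_cobounded_compl_closedBall (0 : ℝ)).eventually_iff.1 hfp.bound
  obtain ⟨M, hM⟩ := (isCompact_closedBall (0 : ℝ) R).exists_bound_of_continuousOn
    (f.continuous.continuousOn)
  refine ⟨max C M, le_max_of_le_left hC, fun y => ?_⟩
  have h0 : 0 ≤ |p.eval y| := abs_nonneg _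
  by_cases hy : y ∈ Metric.closedBall (0 : ℝ) R
  · have h1 := hM y hy
    rw [Real.norm_eq_abs] at h1
    nlinarith [le_max_left C M, le_max_right C M]
  · have h1 := hR.2 hy
    rw [Real.norm_eq_abs, Real.norm_eq_abs] at h1
    nlinarith [le_max_left C M, le_max_right C M]

section Wave

variable {η : ℝ → ℂ} {p : Polynomial ℝ} {r s : ℝ}

theorem waveFun_eq (u : Plane) (x : ℝ) : waveFun η p r s u x
    = 𝐞 (u 0 * x) * η (s * (p.eval (x / r) + u 1)) := by
  rw [waveFun, Real.fourierChar_apply, mul_comm, mul_add]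
  congr 2
  push_cast
  ring

theorem continuous_waveFun (hη : Continuous η) :
    Continuous fun y : Plane × ℝ => waveFun η p r s y.1 y.2 := by
  simp only [waveFun_eq]
  have := p.continuous
  fun_prop

/-- The wave functions decay, uniformly up to a linear growth in the parameter. -/
theorem exists_norm_waveFun_le (hη : Continuous η) (hηc : HasCompactSupport η)
    (hp : 1 ≤ p.natDegree) (hr : r ≠ 0) (hs : s ≠ 0) :
    ∃ C, 0 ≤ C ∧ ∀ (u : Plane) (x : ℝ),
      ‖waveFun η p r s u x‖ ≤ C * (1 + ‖u‖) * (1 + ‖x‖)⁻¹ := by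
  obtain ⟨M, hM⟩ := hηc.exists_bound_of_continuous hη
  obtain ⟨R, hR⟩ := hηc.isCompact.isBounded.subset_closedBall 0
  obtain ⟨C, hC, hCp⟩ := exists_abs_eval_le (f := Polynomial.X) (p := p) (by
    rw [Polynomial.degree_X]
    rw [Polynomial.degree_eq_natDegree (by rintro rfl; simp at hp)]
    exact_mod_cast hp)
  have hM0 : 0 ≤ M := (norm_nonneg _).trans (hM 0)
  set A := 1 + |r| * C * (2 + |R| / |s|)
  have hA : 0 ≤ A := by positivity
  refine ⟨M * A, by positivity, fun u x => ?_⟩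
  rw [waveFun_eq, norm_mul, Circle.norm_coe, one_mul]
  by_cases hx : η (s * (p.eval (x / r) + u 1)) = 0
  · rw [hx, norm_zero]
    positivity
  · have h1 := hR (subset_tsupport _ hx)
    rw [mem_closedBall_zero_iff, norm_mul, Real.norm_eq_abs, Real.norm_eq_abs] at h1
    have hs' : 0 < |s| := abs_pos.2 hs
    have hr' : 0 < |r| := abs_pos.2 hr
    have h2 : |p.eval (x / r) + u 1| ≤ |R| / |s| := by
      rw [le_div_iff₀' hs']
      exact h1.trans (le_abs_self R)
    have h3 : |u 1| ≤ ‖u‖ := PiLp.norm_apply_le u 1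
    have h4 : |p.eval (x / r)| ≤ |R| / |s| + ‖u‖ := by
      have := abs_sub_abs_le_abs_sub (p.eval (x / r)) (-u 1)
      rw [abs_neg, sub_neg_eq_add] at this
      linarith
    have h5 := hCp (x / r)
    rw [Polynomial.eval_X, abs_div, div_le_iff₀ hr'] at h5
    have hRs : 0 ≤ |R| / |s| := by positivity
    have h6 : 1 + ‖x‖ ≤ A * (1 + ‖u‖) := by
      rw [Real.norm_eq_abs]
      have h7 : C * (1 + |p.eval (x / r)|) * |r| ≤ |r| * C * (1 + (|R| / |s| + ‖u‖)) := by
        rw [mul_comm _ |r|, ← mul_assoc]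
        gcongr
      have h8 : |r| * C * (1 + (|R| / |s| + ‖u‖)) ≤ |r| * C * ((2 + |R| / |s|) * (1 + ‖u‖)) := by
        gcongr
        nlinarith [norm_nonneg u, mul_nonneg hRs (norm_nonneg u)]
      calc 1 + |x| ≤ (1 + ‖u‖) + |r| * C * ((2 + |R| / |s|) * (1 + ‖u‖)) := by
            linarith [norm_nonneg u]
        _ = _ := by ring
    rw [← div_eq_mul_inv, le_div_iff₀ (by positivity)]
    calc _ ≤ M * (A * (1 + ‖u‖)) := by
          gcongr
          exact hM _
      _ = _ := by ring

theorem memLp_two_one_add_norm_inv : MemLp (fun x : ℝ => (1 + ‖x‖)⁻¹) 2 := by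
  have hc : Continuous fun x : ℝ => (1 + ‖x‖)⁻¹ :=
    (by fun_prop : Continuous fun x : ℝ => 1 + ‖x‖).inv₀ fun x => by positivity
  rw [memLp_two_iff_integrable_sq hc.aestronglyMeasurable]
  refine (integrable_one_add_norm (r := 2) (by simp)).congr (ae_of_all _ fun x => ?_)
  simp only
  rw [Real.rpow_neg (by positivity), inv_pow, Real.rpow_ofNat]

theorem memLp_waveFun (hη : Continuous η) (hηc : HasCompactSupport η)
    (hp : 1 ≤ p.natDegree) (hr : r ≠ 0) (hs : s ≠ 0) (u : Plane) :
    MemLp (waveFun η p r s u) 2 := by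
  obtain ⟨C, -, hC⟩ := exists_norm_waveFun_le hη hηc hp hr hs
  refine (memLp_two_one_add_norm_inv.const_mul (C * (1 + ‖u‖))).of_le
    ((continuous_waveFun hη).comp (by fun_prop : Continuous fun x => (u, x))).aestronglyMeasurable
    (ae_of_all _ fun x => (hC u x).trans (le_abs_self _))

theorem waveVec_eq (hη : Continuous η) (hηc : HasCompactSupport η)
    (hp : 1 ≤ p.natDegree) (hr : r ≠ 0) (hs : s ≠ 0) (u : Plane) :
    waveVec η p r s u = (memLp_waveFun hη hηc hp hr hs u).toLp _ :=
  dif_pos _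

theorem continuous_waveVec (hη : Continuous η) (hηc : HasCompactSupport η)
    (hp : 1 ≤ p.natDegree) (hr : r ≠ 0) (hs : s ≠ 0) : Continuous (waveVec η p r s) := by
  rw [funext (waveVec_eq hη hηc hp hr hs)]
  obtain ⟨C, hC0, hC⟩ := exists_norm_waveFun_le hη hηc hp hr hs
  refine continuous_toLp_of_dominated _ (ae_of_all _ fun x =>
    (continuous_waveFun hη).comp (by fun_prop : Continuous fun u : Plane => (u, x))) fun u₀ =>
    ⟨_, memLp_two_one_add_norm_inv.const_mul (C * (1 + (‖u₀‖ + 1))), ?_⟩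
  filter_upwards [(continuous_norm.tendsto u₀).eventually (gt_mem_nhds (lt_add_one ‖u₀‖))] with u hu
  refine ae_of_all _ fun x => (hC u x).trans ?_
  gcongr

theorem exists_norm_waveVec_le (hη : Continuous η) (hηc : HasCompactSupport η)
    (hp : 1 ≤ p.natDegree) (hr : r ≠ 0) (hs : s ≠ 0) :
    ∃ C, 0 ≤ C ∧ ∀ u, ‖waveVec η p r s u‖ ≤ C * (1 + ‖u‖) := by
  obtain ⟨C, hC0, hC⟩ := exists_norm_waveFun_le hη hηc hp hr hs
  refine ⟨C * ‖memLp_two_one_add_norm_inv.toLp _‖, by positivity, fun u => ?_⟩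
  have h := Lp.norm_le_mul_norm_of_ae_le_mul (f := waveVec η p r s u)
    (g := memLp_two_one_add_norm_inv.toLp _) (c := C * (1 + ‖u‖)) ?_
  · exact h.trans (le_of_eq (by ring))
  · rw [waveVec_eq hη hηc hp hr hs]
    filter_upwards [(memLp_waveFun hη hηc hp hr hs u).coeFn_toLp,
      memLp_two_one_add_norm_inv.coeFn_toLp] with x h1 h2
    rw [h1, h2]
    refine (hC u x).trans (le_of_eq ?_)
    rw [Real.norm_of_nonneg (by positivity : 0 ≤ (1 + ‖x‖)⁻¹)]

theorem inner_waveVec (hη : Continuous η) (hηc : HasCompactSupport η)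
    (hp : 1 ≤ p.natDegree) (hr : r ≠ 0) (hs : s ≠ 0) (u : Plane) (ξ : L2R) :
    inner ℂ (waveVec η p r s u) ξ
      = ∫ x, 𝐞 (-(u 0 * x)) * star (η (s * (p.eval (x / r) + u 1))) * (ξ : ℝ → ℂ) x := by
  rw [waveVec_eq hη hηc hp hr hs, L2.inner_def]
  refine integral_congr_ae ?_
  filter_upwards [(memLp_waveFun hη hηc hp hr hs u).coeFn_toLp] with x h1
  rw [h1, waveFun_eq, RCLike.inner_apply, map_mul, ← Circle.coe_inv_eq_conj,
    ← AddChar.map_neg_eq_inv, mul_comm]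
  rfl

theorem continuous_waveProj (hη : Continuous η) (hηc : HasCompactSupport η)
    (hp : 1 ≤ p.natDegree) (hr : r ≠ 0) (hs : s ≠ 0) : Continuous (waveProj η p r s) := by
  have h := continuous_waveVec hη hηc hp hr hs
  have h1 : Continuous fun u => innerSL ℂ (waveVec η p r s u) := (innerSL ℂ).continuous.comp h
  have h2 : Continuous fun u =>
      ContinuousLinearMap.smulRightL ℂ L2R L2R (innerSL ℂ (waveVec η p r s u)) :=
    (ContinuousLinearMap.smulRightL ℂ L2R L2R).continuous.comp h1
  refine (h2.clm_apply h).congr fun u => ?_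
  ext1 ξ
  rw [ContinuousLinearMap.smulRightL_apply_apply, waveProj, InnerProductSpace.rankOne_def]

theorem integrable_fourier_smul_waveProj (hη : Continuous η) (hηc : HasCompactSupport η)
    (hp : 1 ≤ p.natDegree) (hr : r ≠ 0) (hs : s ≠ 0) (φ : 𝓢(Plane, ℂ)) :
    Integrable fun u : Plane => 𝓕 (φ : Plane → ℂ) (planeFlip u) • waveProj η p r s u := by
  obtain ⟨C, hC0, hC⟩ := exists_norm_waveVec_le hη hηc hp hr hs
  have hF : Continuous (𝓕 (φ : Plane → ℂ)) := (𝓕 φ).continuous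
  have h1 : Integrable fun u => C ^ 2 * (2 * (‖𝓕 φ u‖ + ‖u‖ ^ 2 * ‖𝓕 φ u‖)) :=
    (((𝓕 φ).integrable.norm.add ((𝓕 φ).integrable_pow_mul volume 2)).const_mul 2).const_mul _
  refine (planeFlip.measurePreserving.integrable_comp_of_integrable h1).mono'
    ((hF.comp planeFlip.continuous).smul (continuous_waveProj hη hηc hp hr hs)).aestronglyMeasurable
    (ae_of_all _ fun u => ?_)
  have h2 : ‖waveProj η p r s u‖ ≤ (C * (1 + ‖u‖)) ^ 2 := by
    rw [waveProj, InnerProductSpace.norm_rankOne, ← sq]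
    gcongr
    exact hC u
  rw [norm_smul, Function.comp, LinearIsometryEquiv.norm_map]
  calc ‖𝓕 (φ : Plane → ℂ) (planeFlip u)‖ * ‖waveProj η p r s u‖
      ≤ ‖𝓕 φ (planeFlip u)‖ * (C * (1 + ‖u‖)) ^ 2 := by
        gcongr
        rfl
    _ ≤ ‖𝓕 φ (planeFlip u)‖ * (C ^ 2 * (2 * (1 + ‖u‖ ^ 2))) := by
        rw [mul_pow]
        gcongr
        nlinarith [sq_nonneg (1 - ‖u‖)]
    _ = _ := by ring

end Wave

/-! ### The maps `ν` as compressions of the regular representation -/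

section Compression

variable {η : ℝ → ℂ} {p : Polynomial ℝ} {r s : ℝ}

theorem continuous_eval_div (p : Polynomial ℝ) (r : ℝ) : Continuous fun x : ℝ => p.eval (x / r) :=
  p.continuous.comp (continuous_id.div_const r)

theorem hasCompactSupport_dilate (hηc : HasCompactSupport η) (hs : 0 < s) :
    HasCompactSupport fun b : ℝ => (√s : ℂ) * star (η (s * b)) := by
  have h : HasCompactSupport fun b : ℝ => η (s * b) :=
    hηc.comp_homeomorph (Homeomorph.mulLeft₀ s hs.ne')
  exact h.comp_left (g := fun z => (√s : ℂ) * star z) (by simp)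

theorem contDiff_dilate (hη : ContDiff ℝ ∞ η) (s : ℝ) :
    ContDiff ℝ ∞ fun b : ℝ => (√s : ℂ) * star (η (s * b)) :=
  contDiff_const.mul (Complex.conjCLE.contDiff.comp (hη.comp (contDiff_const.mul contDiff_id)))

/-- The test function `√s conj (η (s b))` of `b`, which is normalized in `L²(ℝ)` if `η` is. -/
def dilate (hη : ContDiff ℝ ∞ η) (hηc : HasCompactSupport η) (hs : 0 < s) : 𝓢(ℝ, ℂ) :=
  (hasCompactSupport_dilate hηc hs).toSchwartzMap (contDiff_dilate hη s)

theorem dilate_apply (hη : ContDiff ℝ ∞ η) (hηc : HasCompactSupport η) (hs : 0 < s) (b : ℝ) :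
    dilate hη hηc hs b = (√s : ℂ) * star (η (s * b)) := rfl

theorem integrable_packetTransform {q : ℝ → ℝ} (hq : Continuous q) (g : 𝓢(ℝ, ℂ))
    {f : ℝ → ℂ} (hf : Integrable f) :
    Integrable fun x : ℝ × ℝ => f x.1 * packetKernel q g x := by
  have h := hf.mul_prod (g.integrable (μ := volume))
  refine h.congr' (hf.aestronglyMeasurable.comp_fst.mul
    (continuous_packetKernel hq g).aestronglyMeasurable) (ae_of_all _ fun x => ?_)
  rw [norm_mul, norm_mul, norm_packetKernel]

/-- The Fourier transform of a wave packet transform consists of the inner products with the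
wave functions. -/
theorem fourier_packetTransform (hη : Continuous η) (hηc : HasCompactSupport η)
    (hp : 1 ≤ p.natDegree) (hr : r ≠ 0) (hs : 0 < s) {e : 𝓢(ℝ, ℂ)}
    (he : ∀ b, e b = (√s : ℂ) * star (η (s * b))) (hg : ∫⁻ w, ‖(𝓕 e) w‖ₑ ^ 2 = 1)
    {ξ : L2R} (hξ : Integrable (ξ : ℝ → ℂ)) (u : Plane) :
    𝓕 (packetTransform (continuous_eval_div p r) (𝓕 e) hg ξ : Plane → ℂ) u
      = √s * inner ℂ (waveVec η p r s (planeFlip u)) ξ := by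
  set q : ℝ → ℝ := fun x => p.eval (x / r)
  have hq : Continuous q := continuous_eval_div p r
  have h0 : ∀ v : Plane, inner ℝ v u = v 0 * u 0 + v 1 * u 1 := fun v => by
    rw [PiLp.inner_apply, Fin.sum_univ_two]
    simp [mul_comm]
  have hi := integrable_packetTransform hq (𝓕 e) hξ
  rw [Real.fourier_congr_ae (packetTransform_ae hq (𝓕 e) hg ξ), Real.fourier_eq]
  simp only [h0]
  have hi' : Integrable fun x : ℝ × ℝ =>
      𝐞 (-(x.1 * u 0 + x.2 * u 1)) • ((ξ : ℝ → ℂ) x.1 * packetKernel q (𝓕 e) x) := by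
    have h1 : Continuous fun x : ℝ × ℝ => 𝐞 (-(x.1 * u 0 + x.2 * u 1)) := by fun_prop
    refine hi.congr' (h1.aestronglyMeasurable.smul hi.aestronglyMeasurable)
      (ae_of_all _ fun x => ?_)
    rw [Circle.norm_smul]
  rw [integral_plane hi', inner_waveVec hη hηc hp hr hs.ne', ← integral_const_mul]
  congr 1 with x : 1
  -- the integral over the second variable is an inverse Fourier transform at `q x - u 1`
  have h2 : 𝓕⁻ (𝓕 e) (q x - u 1) = e (q x - u 1) := by
    rw [FourierTransform.fourierInv_fourier_eq]
  rw [SchwartzMap.fourierInv_coe, Real.fourierInv_eq'] at h2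
  calc ∫ w, 𝐞 (-(x * u 0 + w * u 1)) • ((ξ : ℝ → ℂ) x * packetKernel q (𝓕 e) (x, w))
      = ∫ w, ((𝐞 (-(u 0 * x)) : ℂ) * (ξ : ℝ → ℂ) x) *
          (Complex.exp ((2 * Real.pi * inner ℝ w (q x - u 1) : ℝ) * Complex.I) • (𝓕 e) w) := by
        congr 1 with w : 1
        have h3 : Complex.exp ((2 * Real.pi * inner ℝ w (q x - u 1) : ℝ) * Complex.I)
            = 𝐞 (w * (q x - u 1)) := by
          rw [Real.fourierChar_apply]
          congr 3
          simp [mul_comm]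
        have h4 : (𝐞 (-(x * u 0 + w * u 1)) : ℂ) * 𝐞 (q x * w)
            = 𝐞 (-(u 0 * x)) * 𝐞 (w * (q x - u 1)) := by
          rw [← Circle.coe_mul, ← Circle.coe_mul, ← AddChar.map_add_eq_mul,
            ← AddChar.map_add_eq_mul]
          congr 2
          ring
        rw [h3, packetKernel, Circle.smul_def, smul_eq_mul, smul_eq_mul]
        linear_combination ((ξ : ℝ → ℂ) x * (𝓕 e) w) * h4
    _ = ((𝐞 (-(u 0 * x)) : ℂ) * (ξ : ℝ → ℂ) x) * e (q x - u 1) := by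
        rw [integral_const_mul, ← h2]
    _ = _ := by
        rw [he]
        simp only [planeFlip_apply, Matrix.cons_val_zero, Matrix.cons_val_one,
          Matrix.cons_val_fin_one, ← sub_eq_add_neg]
        ring

/-- The matrix coefficients of `ν(φ)`. The reflection of the plane accounts for the sign in the
argument `(a, -b)` of the Fourier transform in the definition of `ν`. -/
theorem inner_nuSchwartz (hη : Continuous η) (hηc : HasCompactSupport η)
    (hp : 1 ≤ p.natDegree) (hr : r ≠ 0) (hs : s ≠ 0) (φ : 𝓢(Plane, ℂ)) (ξ ζ : L2R) :
    inner ℂ ζ (nuSchwartz η p r s φ ξ)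
      = ∫ u : Plane, 𝓕 (φ : Plane → ℂ) u * (s * (inner ℂ ζ (waveVec η p r s (planeFlip u))
          * inner ℂ (waveVec η p r s (planeFlip u)) ξ)) := by
  have hi := integrable_fourier_smul_waveProj hη hηc hp hr hs φ
  have h1 : nuSchwartz η p r s φ ξ
      = (s : ℂ) • ∫ u, (𝓕 (φ : Plane → ℂ) (planeFlip u) • waveProj η p r s u) ξ :=
    congrArg (fun x => (s : ℂ) • x) (ContinuousLinearMap.integral_apply hi ξ)
  have hi' : Integrable fun u => (𝓕 (φ : Plane → ℂ) (planeFlip u) • waveProj η p r s u) ξ :=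
    (ContinuousLinearMap.apply ℂ L2R ξ).integrable_comp hi
  rw [h1, inner_smul_right, ← integral_inner hi', ← integral_const_mul,
    ← planeFlip.measurePreserving.integral_comp planeFlip.toMeasurableEquiv.measurableEmbedding]
  congr 1 with u : 1
  rw [planeFlip_planeFlip, _root_.smul_apply, waveProj, InnerProductSpace.rankOne_apply,
    inner_smul_right, inner_smul_right]
  ring

/-- The operator `ν(φ)` is the compression of the convolution by `φ` to the range of a wave packet
transform. -/
theorem nuSchwartz_eq (hη : Continuous η) (hηc : HasCompactSupport η)
    (hp : 1 ≤ p.natDegree) (hr : r ≠ 0) (hs : 0 < s) {e : 𝓢(ℝ, ℂ)}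
    (he : ∀ b, e b = (√s : ℂ) * star (η (s * b))) (hg : ∫⁻ w, ‖(𝓕 e) w‖ₑ ^ 2 = 1)
    (φ : 𝓢(Plane, ℂ)) :
    nuSchwartz η p r s φ
      = ContinuousLinearMap.adjoint
          (packetTransform (continuous_eval_div p r) (𝓕 e) hg).toContinuousLinearMap ∘L
        convOp φ φ.integrable ∘L
          (packetTransform (continuous_eval_div p r) (𝓕 e) hg).toContinuousLinearMap := by
  set V := packetTransform (continuous_eval_div p r) (𝓕 e) hg
  have hV : ∀ {ξ : L2R}, Integrable (ξ : ℝ → ℂ) → Integrable (V ξ : Plane → ℂ) := fun hξ =>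
    (integrable_plane_iff.2 (integrable_packetTransform (continuous_eval_div p r) (𝓕 e) hξ)).congr
      (packetTransform_ae _ _ _ _).symm
  have key : ∀ {ξ ζ : L2R}, Integrable (ξ : ℝ → ℂ) → Integrable (ζ : ℝ → ℂ) →
      inner ℂ ζ (nuSchwartz η p r s φ ξ) = inner ℂ (V ζ) (convOp φ φ.integrable (V ξ)) := by
    intro ξ ζ hξ hζ
    rw [inner_nuSchwartz hη hηc hp hr hs.ne', inner_convOp φ _ _ (hV hζ) (hV hξ)]
    congr 1 with u : 1
    rw [fourier_packetTransform hη hηc hp hr hs he hg hξ,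
      fourier_packetTransform hη hηc hp hr hs he hg hζ, star_mul', ← starRingEnd_apply,
      ← starRingEnd_apply, inner_conj_symm, Complex.conj_ofReal]
    have h1 : (√s : ℂ) * √s = s := by
      rw [← Complex.ofReal_mul, Real.mul_self_sqrt hs.le]
    linear_combination (-(𝓕 (φ : Plane → ℂ) u * (inner ℂ ζ (waveVec η p r s (planeFlip u))
          * inner ℂ (waveVec η p r s (planeFlip u)) ξ))) * h1
  have hdense : DenseRange (fun f : 𝓢(ℝ, ℂ) => f.toLp 2 volume) :=
    SchwartzMap.denseRange_toLpCLM ENNReal.ofNat_ne_top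
  have hint : ∀ f : 𝓢(ℝ, ℂ), Integrable (f.toLp 2 volume : ℝ → ℂ) := fun f =>
    f.integrable.congr (f.coeFn_toLp 2 volume).symm
  set T := ContinuousLinearMap.adjoint V.toContinuousLinearMap ∘L
    convOp φ φ.integrable ∘L V.toContinuousLinearMap with hT
  have h2 : ∀ (f : 𝓢(ℝ, ℂ)) (ζ : L2R), inner ℂ ζ (nuSchwartz η p r s φ (f.toLp 2 volume))
      = inner ℂ ζ (T (f.toLp 2 volume)) := by
    intro f
    refine congrFun (hdense.equalizer (by fun_prop) (by fun_prop) (funext fun f' => ?_))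
    simp only [Function.comp]
    rw [key (hint f) (hint f'), hT, ContinuousLinearMap.comp_apply,
      ContinuousLinearMap.adjoint_inner_right]
    rfl
  have h3 : (nuSchwartz η p r s φ : L2R → L2R) = T :=
    hdense.equalizer (ContinuousLinearMap.continuous _) (ContinuousLinearMap.continuous _)
      (funext fun f => ext_inner_left ℂ (h2 f))
  exact DFunLike.coe_injective h3

end Compression

/-! ### Quantitative estimates -/

theorem lintegral_enorm_sq_eq_ofReal (f : 𝓢(ℝ, ℂ)) :
    ∫⁻ x, ‖f x‖ₑ ^ 2 = ENNReal.ofReal (∫ x, ‖f x‖ ^ 2) := by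
  have hf : Integrable fun x => ‖f x‖ ^ 2 := (f.memLp 2 volume).integrable_norm_pow two_ne_zero
  rw [ofReal_integral_eq_lintegral_ofReal hf (ae_of_all _ fun x => by positivity)]
  congr 1 with x
  rw [← ofReal_norm, ENNReal.ofReal_pow (norm_nonneg _)]

theorem lintegral_enorm_sq_fourier (f : 𝓢(ℝ, ℂ)) :
    ∫⁻ w, ‖(𝓕 f) w‖ₑ ^ 2 = ENNReal.ofReal (∫ x, ‖f x‖ ^ 2) := by
  rw [lintegral_enorm_sq_eq_ofReal, SchwartzMap.integral_norm_sq_fourier]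

theorem integral_norm_sq_comp_mul (F : ℝ → ℂ) {s : ℝ} (hs : 0 < s) :
    ∫ b, s * ‖F (s * b)‖ ^ 2 = ∫ x, ‖F x‖ ^ 2 := by
  rw [integral_const_mul, Measure.integral_comp_mul_left (fun x => ‖F x‖ ^ 2), smul_eq_mul,
    abs_of_pos (inv_pos.2 hs), mul_inv_cancel_left₀ hs.ne']

theorem norm_sqrt_mul_star_sq (z : ℂ) {s : ℝ} (hs : 0 < s) :
    ‖(√s : ℂ) * star z‖ ^ 2 = s * ‖z‖ ^ 2 := by
  rw [norm_mul, norm_star, mul_pow, Complex.norm_real, Real.norm_of_nonneg (Real.sqrt_nonneg s),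
    Real.sq_sqrt hs.le]

section Dilate

variable {η : ℝ → ℂ} {s : ℝ}

theorem lintegral_fourier_dilate (hη : ContDiff ℝ ∞ η) (hηc : HasCompactSupport η)
    (hη1 : ∫ x, ‖η x‖ ^ 2 = 1) (hs : 0 < s) :
    ∫⁻ w, ‖(𝓕 (dilate hη hηc hs)) w‖ₑ ^ 2 = 1 := by
  rw [lintegral_enorm_sq_fourier]
  simp only [dilate_apply, norm_sqrt_mul_star_sq _ hs]
  rw [integral_norm_sq_comp_mul _ hs, hη1, ENNReal.ofReal_one]

/-- Since the dilates of `η` concentrate at the origin, a translation changes their Fourier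
transforms little. -/
theorem lintegral_fourier_dilate_sub_le (hη : ContDiff ℝ ∞ η) (hηc : HasCompactSupport η)
    (hs : 0 < s) (w : ℝ) :
    ∫⁻ v, ‖(𝓕 (dilate hη hηc hs)) (v - w) - (𝓕 (dilate hη hηc hs)) v‖ₑ ^ 2
      ≤ ENNReal.ofReal ((2 * Real.pi * √(∫ x : ℝ, ‖(x : ℂ) * η x‖ ^ 2) / s * |w|) ^ 2) := by
  set e := dilate hη hηc hs
  have hm : ContDiff ℝ ∞ fun b : ℝ => (𝐞 (b * w) : ℂ) - 1 := by
    simp only [Real.fourierChar_apply]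
    have h1 : ContDiff ℝ ∞ fun b : ℝ => 2 * Real.pi * (b * w) := by fun_prop
    exact ((Complex.ofRealCLM.contDiff.comp h1).mul contDiff_const).cexp.sub contDiff_const
  have hc : HasCompactSupport fun b : ℝ => ((𝐞 (b * w) : ℂ) - 1) * e b :=
    (hasCompactSupport_dilate hηc hs).mul_left
  -- by Plancherel, it is enough to estimate `(exp (2πi b w) - 1) e(b)`
  let h : 𝓢(ℝ, ℂ) := hc.toSchwartzMap (hm.mul (contDiff_dilate hη s))
  have hh : ∀ b, h b = ((𝐞 (b * w) : ℂ) - 1) * e b := fun b => rfl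
  have h1 : ∀ v, (𝓕 e) (v - w) - (𝓕 e) v = (𝓕 h) v := by
    intro v
    have hi : ∀ v : ℝ, Integrable fun b => 𝐞 (-(b * v)) • e b := fun v => by
      have hcont : Continuous fun b : ℝ => 𝐞 (-(b * v)) := by fun_prop
      exact e.integrable.congr' (hcont.aestronglyMeasurable.smul e.continuous.aestronglyMeasurable)
        (ae_of_all _ fun b => (Circle.norm_smul _ _).symm)
    rw [SchwartzMap.fourier_coe, SchwartzMap.fourier_coe, Real.fourier_real_eq,
      Real.fourier_real_eq, Real.fourier_real_eq, ← integral_sub (hi _) (hi _)]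
    congr 1 with b : 1
    have h2 : (𝐞 (-(b * (v - w))) : ℂ) = 𝐞 (-(b * v)) * 𝐞 (b * w) := by
      rw [← Circle.coe_mul, ← AddChar.map_add_eq_mul]
      congr 2
      ring
    rw [hh, Circle.smul_def, Circle.smul_def, Circle.smul_def, h2]
    simp only [smul_eq_mul]
    ring
  simp only [h1]
  rw [lintegral_enorm_sq_fourier]
  refine ENNReal.ofReal_le_ofReal ?_
  have hint : Integrable fun x : ℝ => ‖(x : ℂ) * η x‖ ^ 2 := by
    have hcont : Continuous fun x : ℝ => ‖(x : ℂ) * η x‖ ^ 2 := by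
      have := hη.continuous
      fun_prop
    refine hcont.integrable_of_hasCompactSupport ?_
    exact (hηc.mul_left (f := fun x : ℝ => (x : ℂ))).comp_left (g := fun z => ‖z‖ ^ 2) (by simp)
  calc ∫ b, ‖h b‖ ^ 2
      ≤ ∫ b, (2 * Real.pi * |w| / s) ^ 2 * (s * ‖((s * b : ℝ) : ℂ) * η (s * b)‖ ^ 2) := by
        refine integral_mono ((h.memLp 2 volume).integrable_norm_pow two_ne_zero)
          (((hint.comp_mul_left' hs.ne').const_mul s).const_mul _) fun b => ?_
        have h3 : ‖(𝐞 (b * w) : ℂ) - 1‖ ≤ 2 * Real.pi * |w| * |b| := by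
          have := norm_fourierChar_sub_le (b * w) 0
          rw [AddChar.map_zero_eq_one, Circle.coe_one, sub_zero, abs_mul] at this
          linarith
        calc ‖h b‖ ^ 2 = ‖(𝐞 (b * w) : ℂ) - 1‖ ^ 2 * (s * ‖η (s * b)‖ ^ 2) := by
              rw [hh, norm_mul, mul_pow, dilate_apply, norm_sqrt_mul_star_sq _ hs]
          _ ≤ (2 * Real.pi * |w| * |b|) ^ 2 * (s * ‖η (s * b)‖ ^ 2) := by gcongr
          _ = _ := by
              rw [norm_mul, Complex.norm_real, Real.norm_eq_abs, abs_mul, abs_of_pos hs]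
              field_simp
    _ = _ := by
        have h4 := integral_norm_sq_comp_mul (fun x : ℝ => (x : ℂ) * η x) hs
        have h5 : √(∫ x : ℝ, ‖(x : ℂ) * η x‖ ^ 2) ^ 2 = ∫ x : ℝ, ‖(x : ℂ) * η x‖ ^ 2 :=
          Real.sq_sqrt (integral_nonneg fun x => by positivity)
        rw [integral_const_mul, h4]
        conv_lhs => rw [← h5]
        ring

theorem lintegral_mul_fourier_dilate_le (hη : ContDiff ℝ ∞ η) (hηc : HasCompactSupport η)
    (hs : 0 < s) :
    ∫⁻ w : ℝ, ‖(w : ℂ) * (𝓕 (dilate hη hηc hs)) w‖ₑ ^ 2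
      ≤ ENNReal.ofReal ((√(∫ x, ‖deriv η x‖ ^ 2) / (2 * Real.pi) * s) ^ 2) := by
  set e := dilate hη hηc hs
  let d := SchwartzMap.derivCLM ℂ ℂ e
  have hd : ∀ b, d b = deriv e b := fun b => rfl
  have hde : ∀ b, deriv e b = (s : ℂ) * ((√s : ℂ) * star (deriv η (s * b))) := by
    intro b
    have h1 : HasDerivAt (fun b : ℝ => η (s * b)) (s • deriv η (s * b)) b := by
      have h0 := (hη.differentiable (by simp)).differentiableAt.hasDerivAt (x := s * b)
      have h2 : HasDerivAt (fun b : ℝ => s * b) s b := by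
        simpa using (hasDerivAt_id b).const_mul s
      exact h0.scomp b h2
    have h2 := (h1.star).const_mul (√s : ℂ)
    rw [show deriv e b = deriv (fun b : ℝ => (√s : ℂ) * star (η (s * b))) b from rfl]
    refine h2.deriv.trans ?_
    rw [star_smul, star_trivial, Complex.real_smul]
    ring
  have h1 : ∀ w : ℝ, ‖(w : ℂ) * (𝓕 e) w‖ₑ ^ 2
      = ENNReal.ofReal ((2 * Real.pi)⁻¹ ^ 2) * ‖(𝓕 d) w‖ₑ ^ 2 := by
    intro w
    have h2 : (𝓕 d) w = (2 * Real.pi * Complex.I * w) • (𝓕 e) w := by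
      have h3 := Real.fourier_deriv e.integrable e.differentiable d.integrable
      exact congrFun h3 w
    rw [h2, ← ofReal_norm, ← ofReal_norm, ← ENNReal.ofReal_pow (norm_nonneg _),
      ← ENNReal.ofReal_pow (norm_nonneg _), ← ENNReal.ofReal_mul (by positivity), ← mul_pow]
    congr 2
    rw [norm_smul, norm_mul, norm_mul, norm_mul, norm_mul, Complex.norm_I, Complex.norm_real,
      Complex.norm_real, Complex.norm_ofNat, Real.norm_of_nonneg Real.pi_pos.le]
    field_simp
  simp only [h1]
  rw [lintegral_const_mul _ (by
    have := (𝓕 d).continuous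
    fun_prop), lintegral_enorm_sq_fourier, ← ENNReal.ofReal_mul (by positivity)]
  refine ENNReal.ofReal_le_ofReal (le_of_eq ?_)
  have h5 : ∫ b, ‖d b‖ ^ 2 = s ^ 2 * ∫ x, ‖deriv η x‖ ^ 2 := by
    rw [← integral_norm_sq_comp_mul (deriv η) hs, ← integral_const_mul]
    congr 1 with b
    rw [hd, hde, norm_mul, mul_pow, norm_sqrt_mul_star_sq _ hs, Complex.norm_real,
      Real.norm_eq_abs, sq_abs]
  rw [h5, div_mul_eq_mul_div, div_pow, mul_pow,
    Real.sq_sqrt (integral_nonneg fun x => by positivity)]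
  field_simp

end Dilate

/-- A polynomial varies slowly relative to its size. -/
theorem exists_abs_eval_add_sub_le (p : Polynomial ℝ) :
    ∃ C, 0 ≤ C ∧ ∀ y τ,
      |p.eval (y + τ) - p.eval y| ≤ C * (1 + |p.eval y|) * (|τ| * (1 + |τ|) ^ p.natDegree) := by
  rcases eq_or_ne p 0 with rfl | hp
  · exact ⟨0, le_rfl, fun y τ => by simp⟩
  have h1 : ∀ j, ∃ C, 0 ≤ C ∧ ∀ y, |(Polynomial.hasseDeriv j p).eval y| ≤ C * (1 + |p.eval y|) := by
    refine fun j => exists_abs_eval_le ?_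
    rw [Polynomial.degree_eq_natDegree hp]
    refine Polynomial.degree_le_natDegree.trans ?_
    exact_mod_cast (Polynomial.natDegree_hasseDeriv_le p j).trans (Nat.sub_le _ _)
  choose C hC0 hC using h1
  refine ⟨∑ j ∈ Finset.range p.natDegree, C (j + 1), Finset.sum_nonneg fun j _ => hC0 _,
    fun y τ => ?_⟩
  have h2 : p.eval (y + τ) - p.eval y
      = ∑ j ∈ Finset.range p.natDegree, (Polynomial.hasseDeriv (j + 1) p).eval y * τ ^ (j + 1) := by
    have h3 : p.eval (y + τ) = (Polynomial.taylor y p).eval τ := by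
      rw [Polynomial.taylor_eval, add_comm]
    rw [h3, Polynomial.eval_eq_sum_range, Polynomial.natDegree_taylor, Finset.sum_range_succ']
    simp only [Polynomial.taylor_coeff]
    simp
  rw [h2, Finset.sum_mul, Finset.sum_mul]
  refine (Finset.abs_sum_le_sum_abs _ _).trans (Finset.sum_le_sum fun j hj => ?_)
  rw [abs_mul, abs_pow, pow_succ']
  have h4 : |τ| ^ j ≤ (1 + |τ|) ^ p.natDegree :=
    (pow_le_pow_left₀ (abs_nonneg τ) (by linarith) j).trans
      (pow_le_pow_right₀ (by linarith [abs_nonneg τ]) (Finset.mem_range.1 hj).le)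
  have := hC0 (j + 1)
  gcongr
  exact hC _ _

theorem integrable_one_add_norm_sq_inv : Integrable fun x : ℝ => ((1 + ‖x‖) ^ 2)⁻¹ := by
  refine (integrable_one_add_norm (r := 2) (by simp)).congr (ae_of_all _ fun x => ?_)
  simp only
  rw [Real.rpow_neg (by positivity), Real.rpow_ofNat]

theorem exists_norm_schwartz_le (ψ : 𝓢(Plane, ℂ)) (n : ℕ) :
    ∃ C, 0 ≤ C ∧ ∀ t w : ℝ, ‖ψ !₂[t, w]‖ ≤ C * ((1 + |t|) ^ n)⁻¹ * ((1 + ‖w‖) ^ 2)⁻¹ := by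
  have h := SchwartzMap.one_add_le_sup_seminorm_apply (𝕜 := ℂ) (m := (n + 2, 0)) le_rfl le_rfl ψ
  refine ⟨_, le_trans (by positivity) (h 0), fun t w => ?_⟩
  have h1 := h !₂[t, w]
  rw [norm_iteratedFDeriv_zero] at h1
  rw [mul_assoc, ← mul_inv, ← div_eq_mul_inv, le_div_iff₀ (by positivity), mul_comm]
  refine le_trans ?_ h1
  have ht : |t| ≤ ‖(!₂[t, w] : Plane)‖ := by simpa using PiLp.norm_apply_le !₂[t, w] 0
  have hw : ‖w‖ ≤ ‖(!₂[t, w] : Plane)‖ := by simpa using PiLp.norm_apply_le !₂[t, w] 1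
  rw [pow_add]
  gcongr

theorem integrable_schwartz_section (ψ : 𝓢(Plane, ℂ)) (t : ℝ) :
    Integrable fun w => ψ !₂[t, w] := by
  obtain ⟨C, -, hC⟩ := exists_norm_schwartz_le ψ 0
  refine (integrable_one_add_norm_sq_inv.const_mul (C * ((1 + |t|) ^ 0)⁻¹)).mono'
    (ψ.continuous.comp (by fun_prop)).aestronglyMeasurable (ae_of_all _ fun w => hC t w)

theorem exists_norm_fourier_section_le (ψ : 𝓢(Plane, ℂ)) (n : ℕ) :
    ∃ C, 0 ≤ C ∧ ∀ t b : ℝ, ‖𝓕 (fun w => ψ !₂[t, w]) b‖ ≤ C * ((1 + |t|) ^ n)⁻¹ := by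
  obtain ⟨C, hC0, hC⟩ := exists_norm_schwartz_le ψ n
  refine ⟨C * ∫ w : ℝ, ((1 + ‖w‖) ^ 2)⁻¹,
    mul_nonneg hC0 (integral_nonneg fun w => by positivity), fun t b => ?_⟩
  refine (VectorFourier.norm_fourierIntegral_le_integral_norm _ _ _ _ _).trans ?_
  rw [mul_right_comm, ← integral_const_mul]
  exact integral_mono (integrable_schwartz_section ψ t).norm
    (integrable_one_add_norm_sq_inv.const_mul _) fun w => hC t w

/-- The partial Fourier transform of a Schwartz function decays in both variables. -/
theorem exists_norm_fourier_section_mul_le (ψ : 𝓢(Plane, ℂ)) (n : ℕ) :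
    ∃ C, 0 ≤ C ∧ ∀ t b : ℝ,
      ‖𝓕 (fun w => ψ !₂[t, w]) b‖ * (1 + |b|) ≤ C * ((1 + |t|) ^ n)⁻¹ := by
  let ψ' : 𝓢(Plane, ℂ) := LineDeriv.lineDerivOp (!₂[0, 1] : Plane) ψ
  obtain ⟨C₀, hC₀, h₀⟩ := exists_norm_fourier_section_le ψ n
  obtain ⟨C₁, hC₁, h₁⟩ := exists_norm_fourier_section_le ψ' n
  refine ⟨C₀ + C₁, by positivity, fun t b => ?_⟩
  have hd : ∀ w, HasDerivAt (fun w => ψ !₂[t, w]) (ψ' !₂[t, w]) w := by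
    intro w
    have h2 : HasDerivAt (fun w : ℝ => (!₂[t, w] : Plane)) !₂[0, 1] w := by
      have h3 : HasDerivAt (fun w : ℝ => (!₂[t, 0] : Plane) + w • !₂[0, 1]) !₂[0, 1] w := by
        simpa using ((hasDerivAt_id w).smul_const (!₂[0, 1] : Plane)).const_add !₂[t, 0]
      refine h3.congr_of_eventuallyEq (Eventually.of_forall fun w => ?_)
      ext i
      fin_cases i <;> simp
    have h4 := (ψ.differentiableAt (x := !₂[t, w])).hasFDerivAt.comp_hasDerivAt w h2
    exact h4
  have h2 : 𝓕 (fun w => ψ' !₂[t, w]) b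
      = (2 * Real.pi * Complex.I * b) • 𝓕 (fun w => ψ !₂[t, w]) b := by
    have h3 : deriv (fun w => ψ !₂[t, w]) = fun w => ψ' !₂[t, w] := funext fun w => (hd w).deriv
    have h4 := Real.fourier_deriv (integrable_schwartz_section ψ t)
      (fun w => (hd w).differentiableAt) (by
        rw [h3]
        exact integrable_schwartz_section ψ' t)
    rw [h3] at h4
    exact congrFun h4 b
  have h5 : |b| * ‖𝓕 (fun w => ψ !₂[t, w]) b‖ ≤ ‖𝓕 (fun w => ψ' !₂[t, w]) b‖ := by
    rw [h2, norm_smul, norm_mul, norm_mul, norm_mul, Complex.norm_I, Complex.norm_real,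
      Complex.norm_real, Complex.norm_ofNat, Real.norm_of_nonneg Real.pi_pos.le, Real.norm_eq_abs]
    gcongr
    nlinarith [Real.pi_gt_three, abs_nonneg b]
  have := h₀ t b
  have := h₁ t b
  linarith

/-! ### Asymptotic multiplicativity -/

/-- The projection to the range of an isometry `V` realizes, up to a factor `2`, the distance to
the range. -/
theorem norm_sub_adjoint_le {H K : Type*} [NormedAddCommGroup H] [InnerProductSpace ℂ H]
    [CompleteSpace H] [NormedAddCommGroup K] [InnerProductSpace ℂ K] [CompleteSpace K]
    (V : H →ₗᵢ[ℂ] K) (x : K) (χ : H) :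
    ‖x - V (ContinuousLinearMap.adjoint V.toContinuousLinearMap x)‖ ≤ 2 * ‖x - V χ‖ := by
  set A := ContinuousLinearMap.adjoint V.toContinuousLinearMap
  have hA : ∀ y, ‖A y‖ ≤ ‖y‖ := fun y => by
    refine (A.le_opNorm y).trans (mul_le_of_le_one_left (norm_nonneg y) ?_)
    rw [LinearIsometryEquiv.norm_map]
    exact V.norm_toContinuousLinearMap_le
  have hAV : A (V χ) = χ := by
    refine ext_inner_left ℂ fun ζ => ?_
    rw [ContinuousLinearMap.adjoint_inner_right]
    exact V.inner_map_map ζ χ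
  have h : x - V (A x) = (x - V χ) - V (A (x - V χ)) := by
    rw [map_sub, map_sub, hAV]
    abel
  rw [h, two_mul]
  refine (norm_sub_le _ _).trans ?_
  rw [V.norm_map]
  exact add_le_add_right (hA _) _

section Multiplicativity

variable {η : ℝ → ℂ} (hη : ContDiff ℝ ∞ η) (hηc : HasCompactSupport η)
  (hη1 : ∫ x, ‖η x‖ ^ 2 = 1) (p : Polynomial ℝ) (r : ℝ) {s : ℝ} (hs : 0 < s)

/-- The wave packet transform with frequency `p(x / r)` whose envelope is the Fourier transform
of the dilate of `η` by `s`. -/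
def waveIsometry : L2R →ₗᵢ[ℂ] L2Plane :=
  packetTransform (continuous_eval_div p r) (𝓕 (dilate hη hηc hs))
    (lintegral_fourier_dilate hη hηc hη1 hs)

/-- The compression of an operator to the range of the wave packet transform. -/
def waveCompression (T : L2Plane →L[ℂ] L2Plane) : L2R →L[ℂ] L2R :=
  ContinuousLinearMap.adjoint (waveIsometry hη hηc hη1 p r hs).toContinuousLinearMap ∘L T ∘L
    (waveIsometry hη hηc hη1 p r hs).toContinuousLinearMap

theorem continuous_waveCompression : Continuous (waveCompression hη hηc hη1 p r hs) := by
  unfold waveCompression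
  fun_prop

theorem tendsto_nuSchwartz (hp : 1 ≤ p.natDegree) {r : ℝ} (hr : r ≠ 0) (φ : CStarPlane) :
    Tendsto (nuSchwartz η p r s) (comap schwartzToCStar (𝓝 φ))
      (𝓝 (waveCompression hη hηc hη1 p r hs φ)) := by
  have h : nuSchwartz η p r s
      = fun ψ => waveCompression hη hηc hη1 p r hs (schwartzToCStar ψ) :=
    funext fun ψ => nuSchwartz_eq hη.continuous hηc hp hr hs (dilate_apply hη hηc hs) _ ψ
  rw [h]
  exact ((continuous_waveCompression hη hηc hη1 p r hs).comp continuous_subtype_val).continuousAt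
    |>.tendsto.comp tendsto_comap

/-- The range of the wave packet transform is almost invariant under convolutions if `s` and
`r / s` are large. -/
theorem exists_norm_convOp_waveIsometry_sub_le (ψ : 𝓢(Plane, ℂ)) :
    ∃ C, 0 ≤ C ∧ ∀ (r s : ℝ) (hs : 0 < s), 1 ≤ r → ∀ ξ : L2R, ∃ χ : L2R,
      ‖convOp ψ ψ.integrable (waveIsometry hη hηc hη1 p r hs ξ)
        - waveIsometry hη hηc hη1 p r hs χ‖ ≤ C * (s⁻¹ + s / r) * ‖ξ‖ := by
  set n := p.natDegree
  obtain ⟨A, hA0, hA⟩ := exists_abs_eval_add_sub_le p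
  -- the variation of `p` grows like `|t| ^ (n + 1)`; two more powers give integrability in `t`
  obtain ⟨B, hB0, hB⟩ := exists_norm_fourier_section_mul_le ψ (n + 3)
  set M₁ := √(∫ x : ℝ, ‖(x : ℂ) * η x‖ ^ 2)
  set M₂ := √(∫ x, ‖deriv η x‖ ^ 2)
  have hM₁ : 0 ≤ M₁ := Real.sqrt_nonneg _
  have hM₂ : 0 ≤ M₂ := Real.sqrt_nonneg _
  set I₁ := ∫ y : Plane, ‖y‖ * ‖ψ y‖
  set I₂ := ∫ t : ℝ, ((1 + ‖t‖) ^ 2)⁻¹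
  have hI₁ : 0 ≤ I₁ := integral_nonneg fun y => by positivity
  have hI₂ : 0 ≤ I₂ := integral_nonneg fun t => by positivity
  have hπ := Real.pi_pos
  refine ⟨2 * Real.pi * M₁ * I₁ + B * A * M₂ * I₂, by positivity, fun r s hs hr ξ => ?_⟩
  have hr0 : 0 < r := one_pos.trans_le hr
  set κ : ℝ → ℝ := fun t => B * A * M₂ * (s / r) * ((1 + ‖t‖) ^ 2)⁻¹
  have hκ : Integrable κ := integrable_one_add_norm_sq_inv.const_mul _
  have hκ0 : ∀ t, 0 ≤ κ t := fun t => by positivity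
  have h : ∀ t x, ‖𝓕 (fun w => ψ !₂[t, w]) (p.eval (x / r))‖
      * (2 * Real.pi * |p.eval ((x + t) / r) - p.eval (x / r)|) * (M₂ / (2 * Real.pi) * s)
      ≤ κ t := by
    intro t x
    set b := p.eval (x / r)
    have h1 : |p.eval ((x + t) / r) - b| ≤ A * (1 + |b|) * (|t| / r * (1 + |t|) ^ n) := by
      rw [add_div]
      refine (hA (x / r) (t / r)).trans ?_
      rw [abs_div, abs_of_pos hr0]
      gcongr
      exact div_le_self (abs_nonneg t) hr
    have h2 := hB t b
    calc _ = ‖𝓕 (fun w => ψ !₂[t, w]) b‖ * |p.eval ((x + t) / r) - b| * (M₂ * s) := by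
          field_simp
      _ ≤ ‖𝓕 (fun w => ψ !₂[t, w]) b‖ * (A * (1 + |b|) * (|t| / r * (1 + |t|) ^ n))
            * (M₂ * s) := by gcongr
      _ = (‖𝓕 (fun w => ψ !₂[t, w]) b‖ * (1 + |b|))
            * (A * M₂ * (s / r) * (|t| * (1 + |t|) ^ n)) := by ring
      _ ≤ (B * ((1 + |t|) ^ (n + 3))⁻¹) * (A * M₂ * (s / r) * ((1 + |t|) * (1 + |t|) ^ n)) := by
          gcongr
          linarith
      _ = κ t := by
          simp only [κ, Real.norm_eq_abs]
          have : 1 + |t| ≠ 0 := by positivity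
          field_simp
          ring
  obtain ⟨χ, hχ⟩ := exists_norm_convOp_packetTransform_sub_le (continuous_eval_div p r)
    (𝓕 (dilate hη hηc hs)) (lintegral_fourier_dilate hη hηc hη1 hs) ψ
    (K₁ := 2 * Real.pi * M₁ / s) (K₂ := M₂ / (2 * Real.pi) * s) (by positivity) (by positivity)
    (lintegral_fourier_dilate_sub_le hη hηc hs) (lintegral_mul_fourier_dilate_le hη hηc hs)
    hκ hκ0 (integrable_schwartz_section ψ) h ξ
  refine ⟨χ, hχ.trans ?_⟩
  gcongr
  rw [integral_const_mul]
  have h3 : 0 ≤ 2 * Real.pi * M₁ * I₁ * (s / r) := by positivity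
  have h4 : 0 ≤ B * A * M₂ * I₂ * s⁻¹ := by positivity
  calc 2 * Real.pi * M₁ / s * I₁ + B * A * M₂ * (s / r) * I₂
      = 2 * Real.pi * M₁ * I₁ * s⁻¹ + B * A * M₂ * I₂ * (s / r) := by ring
    _ ≤ _ := by linarith

/-- The compressions to the range of `V` of operators `S` and `T` almost multiply if `T` almost
preserves this range. -/
theorem norm_waveCompression_mul_sub_le (S T : L2Plane →L[ℂ] L2Plane) {ε : ℝ} (hε : 0 ≤ ε)
    (hT : ∀ ξ : L2R, ∃ χ : L2R, ‖T (waveIsometry hη hηc hη1 p r hs ξ)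
      - waveIsometry hη hηc hη1 p r hs χ‖ ≤ ε * ‖ξ‖) :
    ‖waveCompression hη hηc hη1 p r hs S ∘L waveCompression hη hηc hη1 p r hs T
      - waveCompression hη hηc hη1 p r hs (S * T)‖ ≤ ‖S‖ * (2 * ε) := by
  refine ContinuousLinearMap.opNorm_le_bound _ (by positivity) fun ξ => ?_
  set V := waveIsometry hη hηc hη1 p r hs
  set A := ContinuousLinearMap.adjoint V.toContinuousLinearMap with hAdef
  have hA : ‖A‖ ≤ 1 := by
    rw [hAdef, LinearIsometryEquiv.norm_map]
    exact V.norm_toContinuousLinearMap_le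
  have h1 : (waveCompression hη hηc hη1 p r hs S ∘L waveCompression hη hηc hη1 p r hs T
      - waveCompression hη hηc hη1 p r hs (S * T)) ξ
      = -A (S (T (V ξ) - V (A (T (V ξ))))) := by
    have h2 : (waveCompression hη hηc hη1 p r hs S ∘L waveCompression hη hηc hη1 p r hs T
      - waveCompression hη hηc hη1 p r hs (S * T)) ξ
      = A (S (V (A (T (V ξ))))) - A (S (T (V ξ))) := rfl
    rw [h2, map_sub, map_sub, neg_sub]
  obtain ⟨χ, hχ⟩ := hT ξ
  rw [h1, norm_neg]
  calc ‖A (S (T (V ξ) - V (A (T (V ξ)))))‖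
      ≤ 1 * (‖S‖ * ‖T (V ξ) - V (A (T (V ξ)))‖) :=
        (A.le_of_opNorm_le hA _).trans (by gcongr; exact S.le_opNorm _)
    _ ≤ 1 * (‖S‖ * (2 * (ε * ‖ξ‖))) := by
        gcongr
        exact (norm_sub_adjoint_le V _ χ).trans (by gcongr)
    _ = ‖S‖ * (2 * ε) * ‖ξ‖ := by ring

/-- The compressions to the range of the wave packet transform are asymptotically multiplicative
on `C*(ℝ²)`. -/
theorem eventually_norm_waveCompression_mul_sub_le {ρ σ : ℕ → ℝ} (hσ : Tendsto σ atTop atTop)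
    (hρ : Tendsto ρ atTop atTop) (hσρ : Tendsto (fun k => σ k / ρ k) atTop (𝓝 0))
    (S T : CStarPlane) {ε : ℝ} (hε : 0 < ε) :
    ∀ᶠ k in atTop, ∀ hk : 0 < σ k,
      ‖waveCompression hη hηc hη1 p (ρ k) hk S ∘L waveCompression hη hηc hη1 p (ρ k) hk T
        - waveCompression hη hηc hη1 p (ρ k) hk (S * T : CStarPlane)‖ ≤ ε := by
  set δ := ε / (4 * (‖(S : L2Plane →L[ℂ] L2Plane)‖ + 1))
  have hδ : 0 < δ := by positivity
  obtain ⟨ψ, hψ⟩ := denseRange_schwartzToCStar.exists_dist_lt T hδ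
  have hψ' : ‖(T : L2Plane →L[ℂ] L2Plane) - convOp ψ ψ.integrable‖ ≤ δ := by
    rw [dist_eq_norm] at hψ
    exact hψ.le
  obtain ⟨C, hC0, hC⟩ := exists_norm_convOp_waveIsometry_sub_le hη hηc hη1 p ψ
  have hlim : Tendsto (fun k => C * ((σ k)⁻¹ + σ k / ρ k)) atTop (𝓝 0) := by
    simpa using ((tendsto_inv_atTop_zero.comp hσ).add hσρ).const_mul C
  filter_upwards [hlim.eventually (gt_mem_nhds hδ), hρ.eventually_ge_atTop 1] with k h1 h2 hk
  refine (norm_waveCompression_mul_sub_le hη hηc hη1 p (ρ k) hk S T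
    (ε := 2 * δ) (by positivity) fun ξ => ?_).trans ?_
  · obtain ⟨χ, hχ⟩ := hC (ρ k) (σ k) hk h2 ξ
    refine ⟨χ, ?_⟩
    set V := waveIsometry hη hηc hη1 p (ρ k) hk
    have h3 : (T : L2Plane →L[ℂ] L2Plane) (V ξ) - V χ
        = ((T : L2Plane →L[ℂ] L2Plane) - convOp ψ ψ.integrable) (V ξ)
          + (convOp ψ ψ.integrable (V ξ) - V χ) := by
      rw [_root_.sub_apply]
      abel
    rw [h3]
    calc _ ≤ δ * ‖V ξ‖ + δ * ‖ξ‖ :=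
          (norm_add_le _ _).trans (add_le_add (ContinuousLinearMap.le_of_opNorm_le _ hψ' _)
            (hχ.trans (by gcongr)))
      _ = 2 * δ * ‖ξ‖ := by
          rw [V.norm_map]
          ring
  · have h4 : (‖(S : L2Plane →L[ℂ] L2Plane)‖ + 1) * (2 * (2 * δ)) = ε := by
      simp only [δ]
      field_simp
      norm_num
    nlinarith

end Multiplicativity

/-! ### Perfect data at a character -/

/-- At a character, the scale tends to infinity and the limit polynomial is not constant. -/
theorem LimitData.IsPerfectFor.rho_and_natDegree {N : ℕ} {ℓ : ℕ → BDual N} {P : LimitData N}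
    (hP : P.IsPerfectFor ℓ) {i : Fin P.m} (hi : i ∈ P.C) :
    Tendsto (P.ρ i) atTop atTop ∧ 1 ≤ (P.p i).natDegree := by
  obtain ⟨j₀, hj₀⟩ := hP.rho_char i hi
  have h1 : Tendsto (P.ρ i) atTop atTop :=
    (hP.rootDist_atTop i hi j₀).congr fun k => (hj₀ k).1.symm
  refine ⟨h1, ?_⟩
  rw [hP.natDegree_p i hi]
  refine Finset.one_le_card.2 ⟨j₀, ?_⟩
  -- otherwise the constant ratio `1` would tend to infinity
  by_contra hj
  have h2 : Tendsto (fun _ : ℕ => (1 : ℝ)) atTop atTop := by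
    refine (hP.notMem_L i hi j₀ hj).congr' ?_
    filter_upwards [h1.eventually_gt_atTop 0] with k hk
    rw [← (hj₀ k).1, div_self hk.ne']
  exact not_tendsto_const_atTop _ _ h2

end

theorem corollary3 (N : ℕ) (hN : 3 ≤ N) (ℓ : ℕ → BDual N) (hℓ : ∀ k, ℓ k ∈ SGen N)
    (σ : ℕ → UnitaryDual (ThreadlikeGroup N)) (hσ : ∀ k, IsClassOf (ℓ k) (σ k))
    (hconv : ProperlyConvergent σ)
    (P : LimitData N) (hP : P.IsPerfectFor ℓ) (s : ℕ → ℝ) (hs : P.Adapted s)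
    (η : ℝ → ℂ) (hη : ContDiff ℝ ∞ η) (hηc : HasCompactSupport η)
    (hη1 : ∫ x, ‖η x‖ ^ 2 = 1) (i : Fin P.m) (hi : i ∈ P.C) :
    (∀ᶠ k in atTop, ∀ φ : CStarPlane,
      Tendsto (nuSchwartz η (P.p i) (P.ρ i k) (s k)) (comap schwartzToCStar (𝓝 φ))
        (𝓝 (P.nu s η i k φ))) ∧
    ∀ φ ψ : CStarPlane,
      Tendsto (fun k => ‖(P.nu s η i k φ).comp (P.nu s η i k ψ) - P.nu s η i k (φ * ψ)‖)
        atTop (𝓝 0) := by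
  obtain ⟨hρ, hp⟩ := hP.rho_and_natDegree hi
  have hs0 : ∀ᶠ k in atTop, 0 < s k ∧ P.ρ i k ≠ 0 := by
    filter_upwards [hs.tendsto_atTop.eventually_gt_atTop 0, hρ.eventually_gt_atTop 0]
      with k h1 h2 using ⟨h1, h2.ne'⟩
  have hnu : ∀ᶠ k in atTop, ∀ hk : 0 < s k, ∀ φ : CStarPlane,
      P.nu s η i k φ = waveCompression hη hηc hη1 (P.p i) (P.ρ i k) hk φ := by
    filter_upwards [hs0] with k h hk φ
    exact (tendsto_nuSchwartz hη hηc hη1 (P.p i) hk hp h.2 φ).limUnder_eq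
  constructor
  · filter_upwards [hs0, hnu] with k h h' φ
    rw [h' h.1]
    exact tendsto_nuSchwartz hη hηc hη1 (P.p i) h.1 hp h.2 φ
  · intro φ ψ
    refine Metric.tendsto_nhds.2 fun ε hε => ?_
    filter_upwards [hs0, hnu, eventually_norm_waveCompression_mul_sub_le hη hηc hη1 (P.p i)
      hs.tendsto_atTop hρ (hs.scale i hi) φ ψ (half_pos hε)] with k h h' h''
    rw [h' h.1, h' h.1, h' h.1, dist_zero_right, norm_norm]
    exact (h'' h.1).trans_lt (half_lt_self hε)
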